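/- Let $R$ be a commutative ring with identity. Call $R$ *coherent* if every finitely generated ideal of $R$ is finitely presented. *Gorenstein rings.* Put $M^*=\operatorname{Hom}_R(M,R)$. A finitely generated $R$-module $M$ belongs to the *G-class* of $R$ if $\operatorname{Ext}^i_R(M,R)=0=\operatorname{Ext}^i_R(M^*,R)$ for all $i>0$ and the natural map $M\to M^{**}$ is an isomorphism. A *G-resolution* of $M$ is a complex $\mathbf G$ of modules from the G-class with $G_i=0$ for $i<0$, $H_i(\mathbf G)=0$ for $i\ne 0$ and $H_0(\mathbf G)\cong M$; its length is $\sup\{i\mid G_i\neq 0\}$ ($0$ for the zero complex). The *G-dimension* of $M$ is the infimum of the lengths of its G-resolutions, and it is finite exactly when $M$ has a G-resolution of finite length. A ring with a unique maximal ideal is *Gorenstein* if every finitely generated ideal has finite G-dimension; in general, $R$ is *Gorenstein* if $R_m$ is Gorenstein for every maximal ideal $m$ of $R$. *Cohen–Macaulay rings.* For a sequence $\mathbf x=x_1,\dots,x_n$ in $R$ and an $R$-module $M$, let $H^i_{\mathbf x}(M)$ be the $i$th right derived functor of the $(\mathbf x)$-torsion functor $\Gamma_{\mathbf x}(M)=\{m\in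 M\mid (\mathbf x)^t m=0 \text{ for some } t\}$, and let $\check H^i_{\mathbf x}(M)$ be the $i$th Čech cohomology of $M$ with respect to $\mathbf x$. The sequence $\mathbf x$ is *weakly proregular* if the natural map $H^i_{\mathbf x}(M)\to\check H^i_{\mathbf x}(M)$ is an isomorphism for all $i\ge 0$ and all $R$-modules $M$. It is a *parameter sequence* if it is weakly proregular, $(\mathbf x)R\neq R$, and $H^n_{\mathbf x}(R)_p\neq 0$ for every prime ideal $p\supseteq(\mathbf x)$. It is a *strong parameter sequence* if $x_1,\dots,x_i$ is a parameter sequence for all $1\le i\le n$. A ring is *Cohen–Macaulay* if every strong parameter sequence (of length $n\geq 1$) on it is a regular sequence, and *locally Cohen–Macaulay* if its localization at every prime ideal is Cohen–Macaulay. **Proposition.** Every coherent Gorenstein ring is locally Cohen–Macaulay. -/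

import Mathlib

namespace CoherentGorenstein

open CategoryTheory

universe u

section Coherent

variable (R : Type u) [CommRing R]

/-- A ring is coherent if each of its finitely generated ideals is finitely presented. -/
def IsCoherentRing : Prop :=
  ∀ I : Ideal R, I.FG → Module.FinitePresentation R I

end Coherent

section Gorenstein

variable (R : Type u) [CommRing R]

/-- `Ext^i_R(M, R) = 0` for all `i > 0`. -/
def ExtVanishes (M : Type u) [AddCommGroup M] [Module R M] : Prop :=
  ∀ i : ℕ, 0 < i → Subsingleton (Abelian.Ext (ModuleCat.of R M) (ModuleCat.of R R) i)

/-- The G-class of `R`: finitely generated reflexive modules `M` such that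
`Ext^i(M, R) = 0 = Ext^i(M^*, R)` for all `i > 0`. -/
structure IsGClass (M : Type u) [AddCommGroup M] [Module R M] : Prop where
  finite : Module.Finite R M
  ext_self : ExtVanishes R M
  ext_dual : ExtVanishes R (Module.Dual R M)
  reflexive : Function.Bijective (Module.Dual.eval R M)

variable {R}

/-- `G` is a G-resolution of `M`: a complex of modules from the G-class, concentrated in
nonnegative degrees, acyclic outside degree `0`, with `H_0(G) ≅ M`. -/
structure IsGResolution (G : ChainComplex (ModuleCat.{u} R) ℕ) (M : ModuleCat.{u} R) :
    Prop where
  mem : ∀ i, IsGClass R (G.X i)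
  exact : ∀ i, i ≠ 0 → G.ExactAt i
  homology_zero : Nonempty (G.homology 0 ≅ M)

/-- The length of a complex: the supremum of the degrees `i` with `G_i ≠ 0`
(it is `0` for the zero complex). -/
noncomputable def complexLength (G : ChainComplex (ModuleCat.{u} R) ℕ) : ℕ∞ :=
  ⨆ (i : ℕ) (_ : Nontrivial (G.X i)), (i : ℕ∞)

variable (R)

/-- The G-dimension: the infimum of the lengths of all G-resolutions of `M`
(it is `⊤` if there is no G-resolution of finite length). -/
noncomputable def gDim (M : Type u) [AddCommGroup M] [Module R M] : ℕ∞ :=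
  ⨅ (G : ChainComplex (ModuleCat.{u} R) ℕ) (_ : IsGResolution G (ModuleCat.of R M)),
    complexLength G

/-- The Gorenstein property of a quasi-local ring: every finitely generated ideal has
finite G-dimension. -/
def IsGorensteinLocalRing [IsLocalRing R] : Prop :=
  ∀ I : Ideal R, I.FG → gDim R I < ⊤

/-- A ring is Gorenstein if all of its localizations at maximal ideals are. -/
def IsGorensteinRing : Prop :=
  ∀ (m : Ideal R) [m.IsMaximal], IsGorensteinLocalRing (Localization.AtPrime m)

end Gorenstein

section Torsion

variable {R : Type u} [CommRing R]

/-- The submodule of `I`-torsion elements: those killed by some power of `I`. -/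
def idealTorsion (I : Ideal R) (M : Type u) [AddCommGroup M] [Module R M] :
    Submodule R M where
  carrier := {m | ∃ t : ℕ, ∀ a ∈ I ^ t, a • m = 0}
  zero_mem' := ⟨0, fun a _ => smul_zero a⟩
  add_mem' := by
    rintro m m' ⟨t, ht⟩ ⟨t', ht'⟩
    refine ⟨t + t', fun a ha => ?_⟩
    rw [smul_add, ht a (Ideal.pow_le_pow_right (Nat.le_add_right t t') ha),
      ht' a (Ideal.pow_le_pow_right (Nat.le_add_left t' t) ha), add_zero]
  smul_mem' := by
    rintro r m ⟨t, ht⟩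
    exact ⟨t, fun a ha => by rw [smul_comm, ht a ha, smul_zero]⟩

theorem mem_idealTorsion {I : Ideal R} {M : Type u} [AddCommGroup M] [Module R M] {m : M} :
    m ∈ idealTorsion I M ↔ ∃ t : ℕ, ∀ a ∈ I ^ t, a • m = 0 := Iff.rfl

theorem map_mem_idealTorsion (I : Ideal R) {M N : Type u} [AddCommGroup M] [Module R M]
    [AddCommGroup N] [Module R N] (f : M →ₗ[R] N) (m : M) (hm : m ∈ idealTorsion I M) :
    f m ∈ idealTorsion I N := by
  obtain ⟨t, ht⟩ := hm
  exact ⟨t, fun a ha => by rw [← map_smul, ht a ha, map_zero]⟩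

/-- The `I`-torsion functor. -/
def torsionFunctor (I : Ideal R) : ModuleCat.{u} R ⥤ ModuleCat.{u} R where
  obj M := ModuleCat.of R (idealTorsion I M)
  map f := ModuleCat.ofHom (f.hom.restrict (map_mem_idealTorsion I f.hom))
  map_id _ := rfl
  map_comp _ _ := rfl

instance (I : Ideal R) : (torsionFunctor I).Additive where
  map_add := rfl

/-- Local cohomology: the right derived functors of the torsion functor. -/
noncomputable def localCohomologyFunctor (I : Ideal R) (i : ℕ) :
    ModuleCat.{u} R ⥤ ModuleCat.{u} R :=
  (torsionFunctor I).rightDerived i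

end Torsion

section Cech

variable {R : Type u} [CommRing R] {n : ℕ} (x : Fin n → R)

/-- The localization of `M` at the powers of the product of the `x i` with `i ∈ s`. -/
abbrev CechLoc (s : Finset (Fin n)) (M : Type u) [AddCommGroup M] [Module R M] : Type u :=
  LocalizedModule (Submonoid.powers (∏ i ∈ s, x i)) M

variable (M N P : Type u) [AddCommGroup M] [Module R M] [AddCommGroup N] [Module R N]
  [AddCommGroup P] [Module R P]

theorem isUnit_cechLoc {s t : Finset (Fin n)} (h : s ⊆ t)
    (a : Submonoid.powers (∏ i ∈ s, x i)) :
    IsUnit (algebraMap R (Module.End R (CechLoc x t M)) a) := by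
  obtain ⟨_, k, rfl⟩ := a
  have hk : IsUnit (algebraMap R (Module.End R (CechLoc x t M)) ((∏ i ∈ t, x i) ^ k)) :=
    IsLocalizedModule.map_units
      (LocalizedModule.mkLinearMap (Submonoid.powers (∏ i ∈ t, x i)) M)
      (⟨_, k, rfl⟩ : Submonoid.powers (∏ i ∈ t, x i))
  have hp : (∏ i ∈ t, x i) ^ k = (∏ i ∈ s, x i) ^ k * (∏ i ∈ t \ s, x i) ^ k := by
    rw [← mul_pow, mul_comm, Finset.prod_sdiff h]
  have hk' := (congrArg (fun a => IsUnit (algebraMap R (Module.End R (CechLoc x t M)) a))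
    hp).mp hk
  rw [map_mul] at hk'
  have hc : Commute (algebraMap R (Module.End R (CechLoc x t M)) ((∏ i ∈ s, x i) ^ k))
      (algebraMap R (Module.End R (CechLoc x t M)) ((∏ i ∈ t \ s, x i) ^ k)) :=
    Algebra.commutes _ _
  exact (hc.isUnit_mul_iff.mp hk').1

/-- The canonical map from the localization at `∏_{i ∈ s} x i` to that at `∏_{i ∈ t} x i`
for `s ⊆ t`. -/
noncomputable def cechRes {s t : Finset (Fin n)} (h : s ⊆ t) :
    CechLoc x s M →ₗ[R] CechLoc x t M :=
  LocalizedModule.lift _ (LocalizedModule.mkLinearMap _ M) (isUnit_cechLoc x M h)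

@[simp]
theorem cechRes_comp_mk {s t : Finset (Fin n)} (h : s ⊆ t) :
    cechRes x M h ∘ₗ LocalizedModule.mkLinearMap _ M = LocalizedModule.mkLinearMap _ M :=
  LocalizedModule.lift_comp _ _ _

theorem cechRes_comp {s t v : Finset (Fin n)} (h : s ⊆ t) (h' : t ⊆ v) :
    cechRes x M h' ∘ₗ cechRes x M h = cechRes x M (h.trans h') := by
  apply IsLocalizedModule.ext (Submonoid.powers (∏ i ∈ s, x i))
    (LocalizedModule.mkLinearMap _ M) (isUnit_cechLoc x M (h.trans h'))
  rw [LinearMap.comp_assoc, cechRes_comp_mk, cechRes_comp_mk, cechRes_comp_mk]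

variable {M N P}

/-- The localization at `∏_{i ∈ s} x i` of a linear map. -/
noncomputable def cechLocMap (s : Finset (Fin n)) (f : M →ₗ[R] N) :
    CechLoc x s M →ₗ[R] CechLoc x s N :=
  IsLocalizedModule.map (Submonoid.powers (∏ i ∈ s, x i))
    (LocalizedModule.mkLinearMap _ M) (LocalizedModule.mkLinearMap _ N) f

theorem cechLocMap_comp_mk (s : Finset (Fin n)) (f : M →ₗ[R] N) :
    cechLocMap x s f ∘ₗ LocalizedModule.mkLinearMap _ M =
      LocalizedModule.mkLinearMap _ N ∘ₗ f :=
  IsLocalizedModule.map_comp _ _ _ _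

theorem cechRes_naturality (f : M →ₗ[R] N) {s t : Finset (Fin n)} (h : s ⊆ t) :
    cechRes x N h ∘ₗ cechLocMap x s f = cechLocMap x t f ∘ₗ cechRes x M h := by
  apply IsLocalizedModule.ext (Submonoid.powers (∏ i ∈ s, x i))
    (LocalizedModule.mkLinearMap _ M) (isUnit_cechLoc x N h)
  rw [LinearMap.comp_assoc, cechLocMap_comp_mk, LinearMap.comp_assoc, cechRes_comp_mk,
    cechLocMap_comp_mk, ← LinearMap.comp_assoc, cechRes_comp_mk]

variable (M)

/-- The Cech cochains of degree `k`: the product of the localizations of `M` at the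
products `∏_{i ∈ s} x i`, over all `k`-element subsets `s` of the index set. -/
abbrev CechCochain (k : ℕ) : Type u :=
  (s : {s : Finset (Fin n) // s.card = k}) → CechLoc x s.1 M

/-- The sign `(-1)^j` where `i` is the `j`-th element of `s`, counted from `0`. -/
def cechSign (s : Finset (Fin n)) (i : Fin n) : R :=
  (-1) ^ (s.filter (· < i)).card

theorem card_erase_of_card {k : ℕ} {s : Finset (Fin n)} (hs : s.card = k + 1) {i : Fin n}
    (hi : i ∈ s) : (s.erase i).card = k := by
  rw [Finset.card_erase_of_mem hi, hs, Nat.add_sub_cancel]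

/-- The Cech differential: the component of `d c` at `s` is the alternating sum of the
images of the components of `c` at the sets `s \ {i}`, for `i ∈ s`. -/
noncomputable def cechD (k : ℕ) : CechCochain x M k →ₗ[R] CechCochain x M (k + 1) :=
  LinearMap.pi fun s => ∑ i : s.1,
    cechSign (R := R) s.1 i.1 • (cechRes x M (Finset.erase_subset i.1 s.1) ∘ₗ
      LinearMap.proj (R := R) (φ := fun s : {s : Finset (Fin n) // s.card = k} =>
        CechLoc x s.1 M) ⟨s.1.erase i.1, card_erase_of_card s.2 i.2⟩)

theorem cechD_apply (k : ℕ) (c : CechCochain x M k)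
    (s : {s : Finset (Fin n) // s.card = k + 1}) :
    cechD x M k c s = ∑ i : s.1, cechSign (R := R) s.1 i.1 •
      cechRes x M (Finset.erase_subset i.1 s.1) (c ⟨s.1.erase i.1, card_erase_of_card s.2 i.2⟩) := by
  simp [cechD]

theorem cechSign_swap (s : Finset (Fin n)) {i j : Fin n} (hi : i ∈ s) (hj : j ∈ s)
    (hij : i ≠ j) :
    cechSign (R := R) s i * cechSign (s.erase i) j +
      cechSign s j * cechSign (s.erase j) i = 0 := by
  wlog h : i < j generalizing i j
  · rw [add_comm]
    exact this hj hi hij.symm (lt_of_le_of_ne (not_lt.mp h) hij.symm)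
  have h1 : ((s.erase i).filter (· < j)).card + 1 = (s.filter (· < j)).card := by
    rw [Finset.filter_erase]
    exact Finset.card_erase_add_one (by simp [hi, h])
  have h2 : ((s.erase j).filter (· < i)).card = (s.filter (· < i)).card := by
    rw [Finset.filter_erase, Finset.erase_eq_of_notMem]
    simp [h.le]
  simp only [cechSign, h2, ← h1]
  ring

theorem cechD_comp_cechD (k : ℕ) : cechD x M (k + 1) ∘ₗ cechD x M k = 0 := by
  refine LinearMap.ext fun c => funext fun s => ?_
  have hcongr : ∀ (a b : {s : Finset (Fin n) // s.card = k}) (ha : a.1 ⊆ s.1)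
      (hb : b.1 ⊆ s.1), a = b → cechRes x M ha (c a) = cechRes x M hb (c b) := by
    rintro a b ha hb rfl
    rfl
  rw [LinearMap.comp_apply, cechD_apply]
  simp only [cechD_apply, map_sum, map_smul, Finset.smul_sum, smul_smul]
  rw [Finset.sum_sigma']
  simp only [← LinearMap.comp_apply (cechRes x M _) (cechRes x M _), cechRes_comp]
  refine Finset.sum_involution
    (fun p _ => ⟨⟨p.2.1, Finset.mem_of_mem_erase p.2.2⟩,
      ⟨p.1.1, Finset.mem_erase.mpr ⟨(Finset.ne_of_mem_erase p.2.2).symm, p.1.2⟩⟩⟩)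
    ?_ ?_ ?_ ?_
  · rintro ⟨⟨i, hi⟩, ⟨j, hj⟩⟩ -
    dsimp only
    have hcard : ((s.1.erase i).erase j).card = k :=
      card_erase_of_card (card_erase_of_card s.2 hi) hj
    have hsub : (s.1.erase i).erase j ⊆ s.1 :=
      (Finset.erase_subset _ _).trans (Finset.erase_subset _ _)
    have hcard' : ((s.1.erase j).erase i).card = k := by
      rw [Finset.erase_right_comm]
      exact hcard
    have hsub' : (s.1.erase j).erase i ⊆ s.1 :=
      (Finset.erase_subset _ _).trans (Finset.erase_subset _ _)
    rw [hcongr ⟨(s.1.erase j).erase i, hcard'⟩ ⟨(s.1.erase i).erase j, hcard⟩ hsub' hsub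
      (Subtype.ext Finset.erase_right_comm), ← add_smul,
      cechSign_swap s.1 hi (Finset.mem_of_mem_erase hj) (Finset.ne_of_mem_erase hj).symm,
      zero_smul]
  · rintro ⟨⟨i, hi⟩, ⟨j, hj⟩⟩ - - h
    have : j = i := congrArg (fun p => p.1.1) h
    exact Finset.ne_of_mem_erase hj this
  · intro _ _
    exact Finset.mem_sigma.mpr ⟨Finset.mem_univ _, Finset.mem_univ _⟩
  · rintro ⟨⟨i, hi⟩, ⟨j, hj⟩⟩ -
    rfl

/-- The Cech complex of `M` with respect to the sequence `x`. -/
noncomputable def cechComplex (M : ModuleCat.{u} R) : CochainComplex (ModuleCat.{u} R) ℕ :=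
  CochainComplex.of (fun k => ModuleCat.of R (CechCochain x M k))
    (fun k => ModuleCat.ofHom (cechD x M k))
    (fun k => by rw [← ModuleCat.ofHom_comp, cechD_comp_cechD]; rfl)

theorem cechComplex_d (M : ModuleCat.{u} R) (k : ℕ) :
    (cechComplex x M).d k (k + 1) = ModuleCat.ofHom (cechD x M k) := by
  simp only [cechComplex, CochainComplex.of_d]

variable {M}

/-- The map on Cech cochains induced by a linear map. -/
noncomputable def cechMapCochain (f : M →ₗ[R] N) (k : ℕ) :
    CechCochain x M k →ₗ[R] CechCochain x N k :=
  LinearMap.pi fun s => cechLocMap x s.1 f ∘ₗ LinearMap.proj s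

theorem cechMapCochain_comm (f : M →ₗ[R] N) (k : ℕ) :
    cechD x N k ∘ₗ cechMapCochain x f k = cechMapCochain x f (k + 1) ∘ₗ cechD x M k := by
  refine LinearMap.ext fun c => funext fun s => ?_
  simp only [LinearMap.comp_apply, cechD_apply, cechMapCochain, LinearMap.pi_apply,
    LinearMap.proj_apply, map_sum, map_smul]
  refine Finset.sum_congr rfl fun i _ => ?_
  rw [← LinearMap.comp_apply, cechRes_naturality, LinearMap.comp_apply]

/-- The Cech complex as a functor of the module. -/
noncomputable def cechFunctor :
    ModuleCat.{u} R ⥤ CochainComplex (ModuleCat.{u} R) ℕ where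
  obj M := cechComplex x M
  map {M N} f := CochainComplex.ofHom
    (fun k => ModuleCat.ofHom (cechMapCochain x f.hom k))
    (fun k => by
      rw [cechComplex_d, cechComplex_d]
      exact ModuleCat.hom_ext (cechMapCochain_comm x f.hom k))
  map_id M := by
    ext k c : 3
    funext s
    exact LinearMap.congr_fun (IsLocalizedModule.map_id _ _) (c s)
  map_comp {M N P} f g := by
    ext k c : 3
    funext s
    exact LinearMap.congr_fun (IsLocalizedModule.map_comp' _ _ _ _ f.hom g.hom) (c s)

instance : (cechFunctor x).Additive where
  map_add {M N f g} := by
    ext k c : 3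
    funext s
    exact LinearMap.congr_fun (map_add (IsLocalizedModule.map _ _ _) f.hom g.hom) (c s)

/-- Cech cohomology. -/
noncomputable def cechCohomology (i : ℕ) (M : ModuleCat.{u} R) : ModuleCat.{u} R :=
  (cechComplex x M).homology i

variable (M)

/-- The ideal generated by the sequence `x`. -/
abbrev seqIdeal : Ideal R := Ideal.span (Set.range x)

/-- The map from the torsion submodule of `M` to the Cech cochains of degree `0`. -/
noncomputable def torsionToCech : idealTorsion (seqIdeal x) M →ₗ[R] CechCochain x M 0 :=
  LinearMap.pi fun _ => LocalizedModule.mkLinearMap _ M ∘ₗ (idealTorsion (seqIdeal x) M).subtype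

theorem cechD_comp_torsionToCech : cechD x M 0 ∘ₗ torsionToCech x M = 0 := by
  refine LinearMap.ext fun m => funext fun s => ?_
  obtain ⟨m, t, ht⟩ := m
  rw [LinearMap.comp_apply, cechD_apply]
  refine Finset.sum_eq_zero fun i _ => ?_
  have h1 : cechRes x M (Finset.erase_subset i.1 s.1)
      (LocalizedModule.mkLinearMap _ M m) = LocalizedModule.mkLinearMap _ M m :=
    LinearMap.congr_fun (cechRes_comp_mk x M (Finset.erase_subset i.1 s.1)) m
  have h2 : LocalizedModule.mkLinearMap (Submonoid.powers (∏ i ∈ s.1, x i)) M m = 0 := by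
    rw [IsLocalizedModule.eq_zero_iff (Submonoid.powers (∏ i ∈ s.1, x i))]
    refine ⟨⟨(∏ i ∈ s.1, x i) ^ t, t, rfl⟩, ht _ (Ideal.pow_mem_pow ?_ t)⟩
    exact Ideal.mem_of_dvd _ (Finset.dvd_prod_of_mem x i.2)
      (Ideal.subset_span (Set.mem_range_self i.1))
  exact (congrArg _ (h1.trans h2)).trans (smul_zero _)

theorem torsionToCech_naturality {M N : Type u} [AddCommGroup M] [Module R M]
    [AddCommGroup N] [Module R N] (f : M →ₗ[R] N) :
    cechMapCochain x f 0 ∘ₗ torsionToCech x M =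
      torsionToCech x N ∘ₗ f.restrict (map_mem_idealTorsion (seqIdeal x) f) := by
  refine LinearMap.ext fun m => funext fun s => ?_
  exact LinearMap.congr_fun (cechLocMap_comp_mk x s.1 f) m.1

end Cech

section NaturalMap

open HomologicalComplex₂

/-- The standard signs for total complexes of bicomplexes indexed by `ℕ × ℕ`. -/
instance : ComplexShape.TensorSigns (ComplexShape.up ℕ) where
  ε' := MonoidHom.mk' (fun i : ℕ => (-1 : ℤˣ) ^ i) (pow_add (-1 : ℤˣ))
  rel_add p q r (hpq : p + 1 = q) := show p + r + 1 = q + r by omega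
  add_rel p q r (hpq : p + 1 = q) := show r + p + 1 = r + q by omega
  ε'_succ := by
    rintro p _ rfl
    exact (pow_succ (-1 : ℤˣ) p).trans (mul_neg_one _)

section Edge

variable {C : Type*} [Category C] [Preadditive C]
  {K : HomologicalComplex₂ C (ComplexShape.up ℕ) (ComplexShape.up ℕ)}
  [K.HasTotal (ComplexShape.up ℕ)] {A : CochainComplex C ℕ}

/-- The morphism to a total complex whose component in degree `q` is a morphism to the summand
of bidegree `(q, 0)`. -/
noncomputable def toTotalOfFst (τ : ∀ q, A.X q ⟶ (K.X q).X 0)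
    (h₁ : ∀ q, τ q ≫ (K.d q (q + 1)).f 0 = A.d q (q + 1) ≫ τ (q + 1))
    (h₂ : ∀ q, τ q ≫ (K.X q).d 0 1 = 0) : A ⟶ K.total (ComplexShape.up ℕ) :=
  CochainComplex.ofHom
    (fun q => τ q ≫ K.ιTotal (ComplexShape.up ℕ) q 0 q (add_zero q))
    (fun q => by
      rw [total_d, Preadditive.comp_add, Category.assoc, Category.assoc, ι_D₁, ι_D₂,
        d₁_eq _ _ (rfl : q + 1 = q + 1) 0 (q + 1) (add_zero (q + 1)),
        d₂_eq _ _ q (rfl : 0 + 1 = 1) (q + 1) rfl, Linear.comp_units_smul,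
        Linear.comp_units_smul, reassoc_of% (h₂ q), reassoc_of% (h₁ q), Limits.zero_comp,
        smul_zero, add_zero]
      exact one_smul _ _)

/-- The morphism to a total complex whose component in degree `p` is a morphism to the summand
of bidegree `(0, p)`. -/
noncomputable def toTotalOfSnd (φ : ∀ p, A.X p ⟶ (K.X 0).X p)
    (h₁ : ∀ p, φ p ≫ (K.d 0 1).f p = 0)
    (h₂ : ∀ p, φ p ≫ (K.X 0).d p (p + 1) = A.d p (p + 1) ≫ φ (p + 1)) :
    A ⟶ K.total (ComplexShape.up ℕ) :=
  CochainComplex.ofHom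
    (fun p => φ p ≫ K.ιTotal (ComplexShape.up ℕ) 0 p p (zero_add p))
    (fun p => by
      rw [total_d, Preadditive.comp_add, Category.assoc, Category.assoc, ι_D₁, ι_D₂,
        d₁_eq _ _ (rfl : 0 + 1 = 1) p (p + 1) (add_comm 1 p),
        d₂_eq _ _ 0 (rfl : p + 1 = p + 1) (p + 1) (zero_add (p + 1)), Linear.comp_units_smul,
        Linear.comp_units_smul, reassoc_of% (h₁ p), reassoc_of% (h₂ p), Limits.zero_comp,
        smul_zero, zero_add]
      exact one_smul _ _)

end Edge

variable {R : Type u} [CommRing R] {n : ℕ} (x : Fin n → R)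

/-- The bicomplex whose `q`-th column is the Cech complex of `C^q`. -/
noncomputable abbrev cechBicomplex (C : CochainComplex (ModuleCat.{u} R) ℕ) :
    HomologicalComplex₂ (ModuleCat.{u} R) (ComplexShape.up ℕ) (ComplexShape.up ℕ) :=
  ((cechFunctor x).mapHomologicalComplex (ComplexShape.up ℕ)).obj C

/-- The total Cech complex of a complex of modules. -/
noncomputable abbrev cechTotal (C : CochainComplex (ModuleCat.{u} R) ℕ) :
    CochainComplex (ModuleCat.{u} R) ℕ :=
  (cechBicomplex x C).total (ComplexShape.up ℕ)

/-- The morphism from the torsion subcomplex of `C` to the total Cech complex of `C`, given by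
the maps from the torsion submodule of `C^q` to the Cech `0`-cochains of `C^q`. -/
noncomputable def torsionToTotal (C : CochainComplex (ModuleCat.{u} R) ℕ) :
    ((torsionFunctor (seqIdeal x)).mapHomologicalComplex (ComplexShape.up ℕ)).obj C ⟶
      cechTotal x C :=
  toTotalOfFst (fun q => ModuleCat.ofHom (torsionToCech x (C.X q)))
    (fun q => ModuleCat.hom_ext (torsionToCech_naturality x (C.d q (q + 1)).hom))
    (fun q => ModuleCat.hom_ext (by
      have h : (cechComplex x (C.X q)).d 0 1 = ModuleCat.ofHom (cechD x (C.X q) 0) :=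
        cechComplex_d x (C.X q) 0
      exact (congrArg (fun g => g.hom ∘ₗ torsionToCech x (C.X q)) h).trans
        (cechD_comp_torsionToCech x (C.X q))))

/-- The morphism from the Cech complex of `M` to the total Cech complex of `C`, induced by a
morphism `M → C^0` whose composite with the differential of `C` is zero. -/
noncomputable def cechToTotal {M : ModuleCat.{u} R} {C : CochainComplex (ModuleCat.{u} R) ℕ}
    (f : M ⟶ C.X 0) (hf : f ≫ C.d 0 1 = 0) : cechComplex x M ⟶ cechTotal x C :=
  toTotalOfSnd (fun p => ((cechFunctor x).map f).f p)
    (fun p => by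
      have h : (cechFunctor x).map f ≫ (cechFunctor x).map (C.d 0 1) = 0 := by
        rw [← Functor.map_comp, hf, Functor.map_zero]
      exact congrArg (fun g => HomologicalComplex.Hom.f g p) h)
    (fun p => ((cechFunctor x).map f).comm p (p + 1))

/-- `η : H^i_x(M) → Č^i_x(M)` is the natural map from local cohomology to Cech cohomology.
For the injective resolution `M → E` it is the composite of the map
`H^i(Γ_x(E)) → H^i(Tot Č(x; E))` induced by the inclusions `Γ_x(E^q) → Č^0(x; E^q)`
with the inverse of the isomorphism `H^i(Č(x; M)) → H^i(Tot Č(x; E))` induced by `M → E^0`. -/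
def IsNaturalMap (i : ℕ) (M : ModuleCat.{u} R)
    (η : (localCohomologyFunctor (seqIdeal x) i).obj M ⟶ cechCohomology x i M) : Prop :=
  let E := injectiveResolution M
  η ≫ HomologicalComplex.homologyMap
      (cechToTotal x (E.ι.f 0) E.ι_f_zero_comp_complex_d) i =
    (E.isoRightDerivedObj (torsionFunctor (seqIdeal x)) i).hom ≫
      HomologicalComplex.homologyMap (torsionToTotal x E.cocomplex) i

/-- The sequence `x` is weakly proregular: for all `i` and `M`, the natural map from local
cohomology to Cech cohomology is an isomorphism. -/
def IsWeaklyProregular : Prop :=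
  ∀ (i : ℕ) (M : ModuleCat.{u} R),
    ∃ η : (localCohomologyFunctor (seqIdeal x) i).obj M ⟶ cechCohomology x i M,
      IsNaturalMap x i M η ∧ IsIso η

end NaturalMap

section CohenMacaulay

variable {R : Type u} [CommRing R] {n : ℕ}

/-- A parameter sequence: `x` is weakly proregular, generates a proper ideal, and
`H^n_x(R)_p ≠ 0` for all primes `p` containing `x`, where `n` is the length of `x`. -/
structure IsParameterSequence (x : Fin n → R) : Prop where
  weaklyProregular : IsWeaklyProregular x
  ne_top : seqIdeal x ≠ ⊤
  nontrivial : ∀ (p : Ideal R) [p.IsPrime], seqIdeal x ≤ p →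
    Nontrivial (LocalizedModule p.primeCompl
      ((localCohomologyFunctor (seqIdeal x) n).obj (ModuleCat.of R R)))

/-- A strong parameter sequence: each nonempty initial segment is a parameter sequence. -/
def IsStrongParameterSequence (x : Fin n → R) : Prop :=
  ∀ (i : ℕ) (h : i ≤ n), 1 ≤ i → IsParameterSequence fun j : Fin i => x (Fin.castLE h j)

variable (R)

/-- A ring is Cohen-Macaulay (in the sense of Hamilton and Marley) if every (nonempty) strong
parameter sequence is a regular sequence. -/
def IsCohenMacaulayRing : Prop :=
  ∀ (n : ℕ) (x : Fin n → R), 1 ≤ n → IsStrongParameterSequence x →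
    RingTheory.Sequence.IsRegular R (List.ofFn x)

/-- A ring is locally Cohen-Macaulay if all of its localizations at primes are
Cohen-Macaulay. -/
def IsLocallyCohenMacaulayRing : Prop :=
  ∀ (p : Ideal R) [p.IsPrime], IsCohenMacaulayRing (Localization.AtPrime p)

end CohenMacaulay

end CoherentGorenstein

/-!
Let `S` be a localization of the given ring at a prime and let `x_1, …, x_n` be a strong parameter
sequence in `S`. Arguing by induction on `n`, the initial segment `x_1, …, x_{n-1}` may be assumed
to be weakly regular. Suppose that `x_n` is a zero divisor on `S/(x_1, …, x_{n-1})`. Then there is a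
prime `p` containing the sequence, minimal over the annihilator of a nonzero element of that
quotient, and `T = S_p` is a coherent ring over which every finitely generated ideal has finite
G-dimension, with a weakly regular sequence of length `n - 1` whose quotient has depth zero.

The Auslander–Bridger argument shows that `Ext^n_T(M, T) = 0` for all cyclic finitely presented
`M` (`HasFiniteGDimension.subsingleton_ext`): a syzygy of `M` far enough out is totally reflexive,
and `IsShortExact.isTotallyReflexive_of_isDepthZeroQuotient` lets one go back along the resolution
as long as the sequence is weakly regular on the syzygy, that is, down to the `(n-1)`-st one.
By coherence, each element of `Ext^n_S(S/(x)^t, S)` is therefore killed by an element outside `p`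
(`exists_smul_eq_zero_of_subsingleton_ext_localized`). The local cohomology module `H^n_x(S)` is
built from these `Ext` modules (`exists_smul_eq_zero_localCohomology`), so it vanishes at `p`, which
contradicts the definition of a parameter sequence.

The modules in a G-resolution are finitely generated but perhaps not finitely presented. Finite
generation is therefore dropped at first, since kernels of surjections between totally reflexive
modules are again totally reflexive (`IsShortExact.isTotallyReflexive_left`); it comes back when the
G-resolution is exchanged for syzygies of a resolution by finite free modules
(`HasTotallyReflexiveResolution.syzygy`), which over a coherent ring are finitely presented.
-/

namespace CoherentGorenstein

open CategoryTheory

universe u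

/-! ### Short exact sequences and `Ext` -/

/-- `0 → L → P → M → 0` is a short exact sequence of modules. -/
structure IsShortExact {R : Type*} [CommRing R] {L P M : Type*} [AddCommGroup L] [Module R L]
    [AddCommGroup P] [Module R P] [AddCommGroup M] [Module R M]
    (i : L →ₗ[R] P) (f : P →ₗ[R] M) : Prop where
  injective : Function.Injective i
  exact : Function.Exact i f
  surjective : Function.Surjective f

theorem isShortExact_ker {R : Type*} [CommRing R] {P M : Type*} [AddCommGroup P] [Module R P]
    [AddCommGroup M] [Module R M] {f : P →ₗ[R] M} (hf : Function.Surjective f) :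
    IsShortExact f.ker.subtype f :=
  ⟨f.ker.injective_subtype, LinearMap.exact_subtype_ker_map f, hf⟩

section Ext

variable {R : Type u} [CommRing R]

variable (R) in
/-- `Ext^n_R(M, N)`, for modules in the universe of `R`. -/
abbrev ModExt (M N : Type u) [AddCommGroup M] [Module R M] [AddCommGroup N] [Module R N]
    (n : ℕ) : Type u :=
  Abelian.Ext (ModuleCat.of R M) (ModuleCat.of R N) n

variable {L P M N N' N'' : Type u} [AddCommGroup L] [Module R L] [AddCommGroup P] [Module R P]
  [AddCommGroup M] [Module R M] [AddCommGroup N] [Module R N] [AddCommGroup N'] [Module R N']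
  [AddCommGroup N''] [Module R N'']

namespace IsShortExact

variable {i : L →ₗ[R] P} {f : P →ₗ[R] M}

theorem comp_eq_zero (h : IsShortExact i f) : f ∘ₗ i = 0 := h.exact.linearMap_comp_eq_zero

/-- The short exact sequence as a short complex in the category of modules. -/
abbrev complex (h : IsShortExact i f) : ShortComplex (ModuleCat.{u} R) :=
  ShortComplex.mk (ModuleCat.ofHom i) (ModuleCat.ofHom f)
    (by rw [← ModuleCat.ofHom_comp, h.comp_eq_zero]; rfl)

theorem shortExact (h : IsShortExact i f) : h.complex.ShortExact :=
  ModuleCat.shortComplex_shortExact _ h.exact h.injective h.surjective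

theorem exists_comp_extClass (h : IsShortExact i f) {n : ℕ} (hP : Subsingleton (ModExt R P N (n + 1)))
    (ξ : ModExt R M N (n + 1)) :
    ∃ η : ModExt R L N n, h.shortExact.extClass.comp η (add_comm 1 n) = ξ :=
  Abelian.Ext.contravariant_sequence_exact₃ h.shortExact _ ξ (Subsingleton.elim _ _) _

theorem subsingleton_ext_left (h : IsShortExact i f) {n : ℕ} (hP : Subsingleton (ModExt R P N n))
    (hM : Subsingleton (ModExt R M N (n + 1))) : Subsingleton (ModExt R L N n) := by
  refine subsingleton_of_forall_eq 0 fun η => ?_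
  obtain ⟨ξ, rfl⟩ := Abelian.Ext.contravariant_sequence_exact₁ h.shortExact _ η (add_comm 1 n)
    (Subsingleton.elim _ _)
  rw [Subsingleton.elim ξ 0, Abelian.Ext.comp_zero]

theorem subsingleton_ext_middle (h : IsShortExact i f) {n : ℕ}
    (hL : Subsingleton (ModExt R L N n)) (hM : Subsingleton (ModExt R M N n)) :
    Subsingleton (ModExt R P N n) := by
  refine subsingleton_of_forall_eq 0 fun η => ?_
  obtain ⟨ξ, rfl⟩ := Abelian.Ext.contravariant_sequence_exact₂ h.shortExact _ η
    (Subsingleton.elim _ _)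
  rw [Subsingleton.elim ξ 0, Abelian.Ext.comp_zero]

theorem subsingleton_ext_right (h : IsShortExact i f) {n : ℕ} (hL : Subsingleton (ModExt R L N n))
    (hP : Subsingleton (ModExt R P N (n + 1))) : Subsingleton (ModExt R M N (n + 1)) := by
  refine subsingleton_of_forall_eq 0 fun ξ => ?_
  obtain ⟨η, rfl⟩ := h.exists_comp_extClass hP ξ
  rw [Subsingleton.elim η 0, Abelian.Ext.comp_zero]

/-- A map `L → N` whose class in `Ext¹(M, N)` vanishes extends along `L → P`. -/
theorem exists_extend_of_comp_eq_zero (h : IsShortExact i f) (φ : L →ₗ[R] N)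
    (hφ : h.shortExact.extClass.comp (Abelian.Ext.mk₀ (ModuleCat.ofHom φ)) (add_zero 1) = 0) :
    ∃ ψ : P →ₗ[R] N, ψ ∘ₗ i = φ := by
  obtain ⟨η, hη⟩ := Abelian.Ext.contravariant_sequence_exact₁ h.shortExact _ _ (add_zero 1) hφ
  obtain ⟨ψ, rfl⟩ := (Abelian.Ext.mk₀_bijective _ _).surjective η
  rw [Abelian.Ext.mk₀_comp_mk₀] at hη
  exact ⟨ψ.hom, congrArg ModuleCat.Hom.hom ((Abelian.Ext.mk₀_bijective _ _).injective hη)⟩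

theorem exists_extend (h : IsShortExact i f) (hM : Subsingleton (ModExt R M N 1))
    (φ : L →ₗ[R] N) : ∃ ψ : P →ₗ[R] N, ψ ∘ₗ i = φ :=
  h.exists_extend_of_comp_eq_zero φ (Subsingleton.elim _ _)

theorem extClass_comp_eq_zero (h : IsShortExact i f) (ψ : P →ₗ[R] N) :
    h.shortExact.extClass.comp (Abelian.Ext.mk₀ (ModuleCat.ofHom (ψ ∘ₗ i))) (add_zero 1) = 0 := by
  rw [ModuleCat.ofHom_comp, ← Abelian.Ext.mk₀_comp_mk₀]
  exact h.shortExact.extClass_comp_assoc _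

theorem subsingleton_ext_one (h : IsShortExact i f) (hP : Subsingleton (ModExt R P N 1))
    (he : ∀ φ : L →ₗ[R] N, ∃ ψ : P →ₗ[R] N, ψ ∘ₗ i = φ) : Subsingleton (ModExt R M N 1) := by
  refine subsingleton_of_forall_eq 0 fun ξ => ?_
  obtain ⟨η, rfl⟩ := h.exists_comp_extClass hP ξ
  obtain ⟨φ, rfl⟩ := (Abelian.Ext.mk₀_bijective _ _).surjective η
  obtain ⟨ψ, hψ⟩ := he φ.hom
  have := h.extClass_comp_eq_zero ψ
  rw [hψ] at this
  exact this

end IsShortExact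

section Covariant

variable {j : N' →ₗ[R] N} {q : N →ₗ[R] N''}

theorem IsShortExact.subsingleton_ext_covariant (h : IsShortExact j q) {n : ℕ}
    (hN : Subsingleton (ModExt R M N n)) (hN' : Subsingleton (ModExt R M N' (n + 1))) :
    Subsingleton (ModExt R M N'' n) := by
  refine subsingleton_of_forall_eq 0 fun ξ => ?_
  obtain ⟨η, rfl⟩ := Abelian.Ext.covariant_sequence_exact₃ _ h.shortExact ξ rfl
    (Subsingleton.elim _ _)
  rw [Subsingleton.elim η 0, Abelian.Ext.zero_comp]

theorem IsShortExact.exists_lift (h : IsShortExact j q) (hN' : Subsingleton (ModExt R M N' 1))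
    (φ : M →ₗ[R] N'') : ∃ ψ : M →ₗ[R] N, q ∘ₗ ψ = φ := by
  obtain ⟨η, hη⟩ := Abelian.Ext.covariant_sequence_exact₃ _ h.shortExact
    (Abelian.Ext.mk₀ (ModuleCat.ofHom φ)) (zero_add 1) (Subsingleton.elim _ _)
  obtain ⟨ψ, rfl⟩ := (Abelian.Ext.mk₀_bijective _ _).surjective η
  rw [Abelian.Ext.mk₀_comp_mk₀] at hη
  exact ⟨ψ.hom, congrArg ModuleCat.Hom.hom ((Abelian.Ext.mk₀_bijective _ _).injective hη)⟩

end Covariant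

theorem subsingleton_ext_of_projective [Module.Projective R P] (n : ℕ) :
    Subsingleton (ModExt R P N (n + 1)) :=
  haveI : Projective (ModuleCat.of R P) := (IsProjective.iff_projective P).mp inferInstance
  Abelian.Ext.subsingleton_of_projective _ _ _

end Ext

/-! ### Coherent rings, totally reflexive modules and resolutions by them -/

section Coherent

variable {R : Type u} [CommRing R] {M N P : Type u} [AddCommGroup M] [Module R M]
  [AddCommGroup N] [Module R N] [AddCommGroup P] [Module R P]

theorem IsCoherentRing.finitePresentation_of_injective_pi (hR : IsCoherentRing R) (n : ℕ) :
    ∀ (M : Type u) [AddCommGroup M] [Module R M] [Module.Finite R M] (f : M →ₗ[R] (Fin n → R)),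
      Function.Injective f → Module.FinitePresentation R M := by
  induction n with
  | zero =>
    intro M _ _ _ f hf
    have := hf.subsingleton
    infer_instance
  | succ n ih =>
    intro M _ _ _ f hf
    let g : M →ₗ[R] R := LinearMap.proj 0 ∘ₗ f
    have hI : Module.FinitePresentation R g.range :=
      hR _ (Module.Finite.iff_fg.mp inferInstance)
    have hK : Module.Finite R g.rangeRestrict.ker :=
      Module.Finite.iff_fg.mpr
        (Module.FinitePresentation.fg_ker g.rangeRestrict g.surjective_rangeRestrict)
    have hK' : Module.FinitePresentation R g.rangeRestrict.ker := by
      refine ih _ (LinearMap.pi (fun j : Fin n => LinearMap.proj j.succ) ∘ₗ f ∘ₗ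
        g.rangeRestrict.ker.subtype) ?_
      rw [injective_iff_map_eq_zero]
      rintro ⟨m, hm⟩ h
      refine Subtype.ext (hf ?_)
      rw [LinearMap.ker_rangeRestrict] at hm
      refine funext fun j => Fin.cases ?_ (fun j => ?_) j
      · simpa [g] using hm
      · simpa using congrFun h j
    exact Module.finitePresentation_of_ker g.rangeRestrict g.surjective_rangeRestrict

/-- Over a coherent ring, finitely generated submodules of finite free modules are finitely
presented. -/
theorem IsCoherentRing.finitePresentation_of_injective (hR : IsCoherentRing R)
    [Module.Finite R M] [Module.Free R P] [Module.Finite R P] (f : M →ₗ[R] P)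
    (hf : Function.Injective f) : Module.FinitePresentation R M := by
  let e := (Module.Free.chooseBasis R P).reindex (Fintype.equivFin _)
  exact hR.finitePresentation_of_injective_pi _ M (e.equivFun.toLinearMap ∘ₗ f)
    (e.equivFun.injective.comp hf)

theorem IsCoherentRing.finitePresentation_ker (hR : IsCoherentRing R)
    [Module.FinitePresentation R M] [Module.Free R P] [Module.Finite R P] {f : P →ₗ[R] M}
    (hf : Function.Surjective f) : Module.FinitePresentation R f.ker :=
  have : Module.Finite R f.ker :=
    Module.Finite.iff_fg.mpr (Module.FinitePresentation.fg_ker f hf)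
  hR.finitePresentation_of_injective f.ker.subtype f.ker.injective_subtype

theorem IsCoherentRing.finitePresentation_ker_of_free (hR : IsCoherentRing R)
    [Module.Free R M] [Module.Finite R M] [Module.Free R P] [Module.Finite R P] (φ : P →ₗ[R] M) :
    Module.FinitePresentation R φ.ker := by
  have : Module.FinitePresentation R φ.range :=
    hR.finitePresentation_of_injective φ.range.subtype φ.range.injective_subtype
  have := hR.finitePresentation_ker φ.surjective_rangeRestrict
  rwa [LinearMap.ker_rangeRestrict] at this

theorem IsCoherentRing.finitePresentation_dual (hR : IsCoherentRing R)
    [Module.FinitePresentation R M] : Module.FinitePresentation R (Module.Dual R M) := by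
  obtain ⟨n, f, hf⟩ := Module.Finite.exists_fin' R M
  have := hR.finitePresentation_ker hf
  obtain ⟨k, g, hg⟩ := Module.Finite.exists_fin' R f.ker
  have hg' : (f.ker.subtype ∘ₗ g).range = f.ker := by
    rw [LinearMap.range_comp_of_range_eq_top _ (LinearMap.range_eq_top.mpr hg),
      Submodule.range_subtype]
  -- `M^*` is the kernel of the transpose of the presentation matrix of `M`.
  have hφ : (f.ker.subtype ∘ₗ g).dualMap.ker = f.dualMap.range := by
    rw [LinearMap.ker_dualMap_eq_dualAnnihilator_range, hg',
      LinearMap.range_dualMap_eq_dualAnnihilator_ker_of_surjective _ hf]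
  have hk := hR.finitePresentation_ker_of_free (f.ker.subtype ∘ₗ g).dualMap
  rw [hφ] at hk
  exact Module.FinitePresentation.of_equiv (M := f.dualMap.range) (N := Module.Dual R M)
    (LinearEquiv.ofInjective f.dualMap (LinearMap.dualMap_injective_of_surjective hf)).symm

end Coherent

section TotallyReflexive

variable (R : Type u) [CommRing R]

/-- Total reflexivity, here without finite generation: the remaining conditions of the G-class. -/
structure IsTotallyReflexive (M : Type u) [AddCommGroup M] [Module R M] : Prop where
  ext_self : ExtVanishes R M
  ext_dual : ExtVanishes R (Module.Dual R M)
  reflexive : Function.Bijective (Module.Dual.eval R M)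

variable {R}

variable {L P M : Type u} [AddCommGroup L] [Module R L] [AddCommGroup P] [Module R P]
  [AddCommGroup M] [Module R M]

theorem ExtVanishes.succ (h : ExtVanishes R M) (n : ℕ) : Subsingleton (ModExt R M R (n + 1)) :=
  h _ n.succ_pos

theorem extVanishes_of_succ (h : ∀ n, Subsingleton (ModExt R M R (n + 1))) : ExtVanishes R M := by
  rintro (_ | n) hn
  · exact absurd hn (lt_irrefl 0)
  · exact h n

theorem extVanishes_of_projective [Module.Projective R P] : ExtVanishes R P :=
  extVanishes_of_succ subsingleton_ext_of_projective

theorem isTotallyReflexive_of_free [Module.Free R P] [Module.Finite R P] :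
    IsTotallyReflexive R P :=
  ⟨extVanishes_of_projective, extVanishes_of_projective, Module.bijective_dual_eval R P⟩

namespace IsShortExact

section Ladder

variable {L' P' M' : Type*} [AddCommGroup L'] [Module R L'] [AddCommGroup P'] [Module R P']
  [AddCommGroup M'] [Module R M'] {i : L →ₗ[R] P} {f : P →ₗ[R] M} {i' : L' →ₗ[R] P'}
  {f' : P' →ₗ[R] M'} {a : L →ₗ[R] L'} {b : P →ₗ[R] P'} {c : M →ₗ[R] M'}

theorem bijective_left (h : IsShortExact i f) (h' : IsShortExact i' f')
    (hab : ∀ x, i' (a x) = b (i x)) (hbc : ∀ x, f' (b x) = c (f x))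
    (hb : Function.Bijective b) (hc : Function.Bijective c) : Function.Bijective a := by
  constructor
  · intro x y hxy
    apply h.injective
    apply hb.1
    rw [← hab, ← hab, hxy]
  · intro y
    obtain ⟨p, hp⟩ := hb.2 (i' y)
    have : f p = 0 := hc.1 (by rw [← hbc, hp, h'.exact.apply_apply_eq_zero, map_zero])
    obtain ⟨x, rfl⟩ := (h.exact p).mp this
    exact ⟨x, h'.injective (by rw [hab, hp])⟩

theorem bijective_right (h : IsShortExact i f) (h' : IsShortExact i' f')
    (hab : ∀ x, i' (a x) = b (i x)) (hbc : ∀ x, f' (b x) = c (f x))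
    (ha : Function.Bijective a) (hb : Function.Bijective b) : Function.Bijective c := by
  constructor
  · rw [injective_iff_map_eq_zero]
    intro m hm
    obtain ⟨p, rfl⟩ := h.surjective m
    rw [← hbc] at hm
    obtain ⟨l', hl'⟩ := (h'.exact _).mp hm
    obtain ⟨l, rfl⟩ := ha.2 l'
    rw [hab] at hl'
    rw [← hb.1 hl', h.exact.apply_apply_eq_zero]
  · intro m
    obtain ⟨p', rfl⟩ := h'.surjective m
    obtain ⟨p, rfl⟩ := hb.2 p'
    exact ⟨f p, (hbc p).symm⟩

theorem bijective_middle (h : IsShortExact i f) (h' : IsShortExact i' f')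
    (hab : ∀ x, i' (a x) = b (i x)) (hbc : ∀ x, f' (b x) = c (f x))
    (ha : Function.Bijective a) (hc : Function.Bijective c) : Function.Bijective b := by
  constructor
  · rw [injective_iff_map_eq_zero]
    intro p hp
    have : f p = 0 := hc.1 (by rw [← hbc, hp, map_zero, map_zero])
    obtain ⟨l, rfl⟩ := (h.exact _).mp this
    rw [← hab] at hp
    rw [ha.1 ((h'.injective (hp.trans (map_zero _).symm)).trans (map_zero a).symm), map_zero]
  · intro p'
    obtain ⟨m, hm⟩ := hc.2 (f' p')
    obtain ⟨p, rfl⟩ := h.surjective m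
    have : f' (p' - b p) = 0 := by rw [map_sub, hbc, hm, sub_self]
    obtain ⟨l', hl'⟩ := (h'.exact _).mp this
    obtain ⟨l, rfl⟩ := ha.2 l'
    exact ⟨i l + p, by rw [map_add, ← hab, hl', sub_add_cancel]⟩

end Ladder

variable {i : L →ₗ[R] P} {f : P →ₗ[R] M}

theorem dual (h : IsShortExact i f) (hM : Subsingleton (ModExt R M R 1)) :
    IsShortExact f.dualMap i.dualMap where
  injective := LinearMap.dualMap_injective_of_surjective h.surjective
  exact := by
    rw [LinearMap.exact_iff, LinearMap.ker_dualMap_eq_dualAnnihilator_range,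
      LinearMap.range_dualMap_eq_dualAnnihilator_ker_of_surjective _ h.surjective,
      h.exact.linearMap_ker_eq]
  surjective := h.exists_extend hM

theorem exists_factor {K : Type*} [AddCommGroup K] [Module R K] (h : IsShortExact i f)
    (φ : K →ₗ[R] P) (hφ : ∀ k, f (φ k) = 0) : ∃ α : K →ₗ[R] L, ∀ k, i (α k) = φ k := by
  refine ⟨(LinearEquiv.ofInjective i h.injective).symm.toLinearMap ∘ₗ
    φ.codRestrict i.range fun k => (h.exact _).mp (hφ k), fun k => ?_⟩
  exact congrArg Subtype.val ((LinearEquiv.ofInjective i h.injective).apply_symm_apply _)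

/-- The kernel of a surjection between totally reflexive modules is totally reflexive. -/
theorem isTotallyReflexive_left (h : IsShortExact i f) (hP : IsTotallyReflexive R P)
    (hM : IsTotallyReflexive R M) : IsTotallyReflexive R L := by
  have hd := h.dual (hM.ext_self.succ 0)
  -- A functional on `M^*` is evaluation at some `f p`, so it extends to `P^*`.
  have hL1 : Subsingleton (ModExt R (Module.Dual R L) R 1) := by
    refine hd.subsingleton_ext_one (hP.ext_dual.succ 0) fun φ => ?_
    obtain ⟨m, rfl⟩ := hM.reflexive.2 φ
    obtain ⟨p, rfl⟩ := h.surjective m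
    exact ⟨Module.Dual.eval R P p, rfl⟩
  refine ⟨extVanishes_of_succ fun n =>
      h.subsingleton_ext_left (hP.ext_self.succ n) (hM.ext_self.succ (n + 1)),
    extVanishes_of_succ fun n => ?_,
    h.bijective_left (hd.dual hL1) (fun _ => rfl) (fun _ => rfl) hP.reflexive hM.reflexive⟩
  obtain ⟨⟩ | n := n
  · exact hL1
  · exact hd.subsingleton_ext_right (hM.ext_dual.succ n) (hP.ext_dual.succ (n + 1))

theorem isTotallyReflexive_middle (h : IsShortExact i f) (hL : IsTotallyReflexive R L)
    (hM : IsTotallyReflexive R M) : IsTotallyReflexive R P := by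
  have hd := h.dual (hM.ext_self.succ 0)
  exact ⟨extVanishes_of_succ fun n =>
      h.subsingleton_ext_middle (hL.ext_self.succ n) (hM.ext_self.succ n),
    extVanishes_of_succ fun n =>
      hd.subsingleton_ext_middle (hM.ext_dual.succ n) (hL.ext_dual.succ n),
    h.bijective_middle (hd.dual (hL.ext_dual.succ 0)) (fun _ => rfl) (fun _ => rfl)
      hL.reflexive hM.reflexive⟩

/-- A cokernel of totally reflexive modules is totally reflexive as soon as the dual sequence
is exact. -/
theorem isTotallyReflexive_right (h : IsShortExact i f) (hL : IsTotallyReflexive R L)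
    (hP : IsTotallyReflexive R P) (hi : Function.Surjective i.dualMap) :
    IsTotallyReflexive R M := by
  have hM1 : Subsingleton (ModExt R M R 1) := h.subsingleton_ext_one (hP.ext_self.succ 0) hi
  have hd := h.dual hM1
  refine ⟨extVanishes_of_succ fun n => ?_,
    extVanishes_of_succ fun n =>
      hd.subsingleton_ext_left (hP.ext_dual.succ n) (hL.ext_dual.succ (n + 1)),
    h.bijective_right (hd.dual (hL.ext_dual.succ 0)) (fun _ => rfl) (fun _ => rfl)
      hL.reflexive hP.reflexive⟩
  obtain ⟨⟩ | n := n
  · exact hM1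
  · exact h.subsingleton_ext_right (hL.ext_self.succ n) (hP.ext_self.succ (n + 1))

end IsShortExact

theorem isShortExact_prod : IsShortExact (LinearMap.inl R L M) (LinearMap.snd R L M) :=
  ⟨LinearMap.inl_injective, Function.Exact.inl_snd, LinearMap.snd_surjective⟩

theorem IsTotallyReflexive.prod (hL : IsTotallyReflexive R L) (hM : IsTotallyReflexive R M) :
    IsTotallyReflexive R (L × M) :=
  isShortExact_prod.isTotallyReflexive_middle hL hM

variable (R) in
/-- `M` has a resolution `0 → G_n → ⋯ → G_0 → M → 0` by totally reflexive modules, not required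
to be finitely generated. -/
def HasTotallyReflexiveResolution : ℕ → ∀ (M : Type u) [AddCommGroup M] [Module R M], Prop
  | 0, M, _, _ => IsTotallyReflexive R M
  | n + 1, M, _, _ => ∃ (L G : Type u) (_ : AddCommGroup L) (_ : Module R L)
      (_ : AddCommGroup G) (_ : Module R G) (i : L →ₗ[R] G) (f : G →ₗ[R] M),
      HasTotallyReflexiveResolution n L ∧ IsTotallyReflexive R G ∧ IsShortExact i f

variable (R) in
/-- `M` has a finitely presented totally reflexive `n`-th syzygy with respect to a resolution by
finite free modules. -/
def HasTotallyReflexiveSyzygy : ℕ → ∀ (M : Type u) [AddCommGroup M] [Module R M], Prop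
  | 0, M, _, _ => Module.FinitePresentation R M ∧ IsTotallyReflexive R M
  | n + 1, M, _, _ => ∃ (L P : Type u) (_ : AddCommGroup L) (_ : Module R L)
      (_ : AddCommGroup P) (_ : Module R P) (i : L →ₗ[R] P) (f : P →ₗ[R] M),
      HasTotallyReflexiveSyzygy n L ∧ Module.Free R P ∧ Module.Finite R P ∧ IsShortExact i f

theorem HasTotallyReflexiveResolution.prod {n : ℕ} (hL : HasTotallyReflexiveResolution R n L)
    (hP : IsTotallyReflexive R P) : HasTotallyReflexiveResolution R n (L × P) := by
  obtain ⟨⟩ | n := n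
  · exact IsTotallyReflexive.prod hL hP
  · obtain ⟨L', G, _, _, _, _, i, f, hL', hG, h⟩ := hL
    refine ⟨L', G × P, _, _, _, _, LinearMap.inl R G P ∘ₗ i, f.prodMap LinearMap.id, hL',
      hG.prod hP, LinearMap.inl_injective.comp h.injective, ?_,
      h.surjective.prodMap Function.surjective_id⟩
    rintro ⟨g, p⟩
    constructor
    · intro hgp
      obtain ⟨l, rfl⟩ := (h.exact g).mp (congrArg Prod.fst hgp)
      exact ⟨l, Prod.ext rfl (congrArg Prod.snd hgp).symm⟩
    · rintro ⟨l, hl⟩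
      rw [← hl]
      exact Prod.ext (h.exact.apply_apply_eq_zero l) rfl

/-- The kernel of a surjection from a module with a resolution of length `n` onto a totally
reflexive module again has one. -/
theorem HasTotallyReflexiveResolution.of_isShortExact {n : ℕ} {i : L →ₗ[R] P} {f : P →ₗ[R] M}
    (h : IsShortExact i f) (hP : HasTotallyReflexiveResolution R n P)
    (hM : IsTotallyReflexive R M) : HasTotallyReflexiveResolution R n L := by
  obtain ⟨⟩ | n := n
  · exact h.isTotallyReflexive_left hP hM
  · obtain ⟨K, G, _, _, _, _, j, p, hK, hG, hp⟩ := hP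
    have hker := isShortExact_ker (f := f ∘ₗ p) (h.surjective.comp hp.surjective)
    obtain ⟨α, hα⟩ := h.exists_factor (p ∘ₗ (f ∘ₗ p).ker.subtype) fun k => k.2
    obtain ⟨β, hβ⟩ := hker.exists_factor j fun k => by
      simp [hp.exact.apply_apply_eq_zero]
    refine ⟨K, (f ∘ₗ p).ker, _, _, _, _, β, α, hK, hker.isTotallyReflexive_left hG hM, ?_, ?_, ?_⟩
    · intro x y hxy
      exact hp.injective (by rw [← hβ, ← hβ, hxy])
    · intro x
      constructor
      · intro hx
        have : p x = 0 := by simpa [hx] using (hα x).symm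
        obtain ⟨k, hk⟩ := (hp.exact _).mp this
        exact ⟨k, Subtype.ext ((hβ k).trans hk)⟩
      · rintro ⟨k, rfl⟩
        apply h.injective
        rw [hα, map_zero]
        exact (congrArg p (hβ k)).trans (hp.exact.apply_apply_eq_zero k)
    · intro l
      obtain ⟨g, hg⟩ := hp.surjective (i l)
      refine ⟨⟨g, ?_⟩, h.injective ?_⟩
      · simp [hg, h.exact.apply_apply_eq_zero]
      · rw [hα]; exact hg

/-- A syzygy of a module with a resolution of length `n + 1` has one of length `n`: if
`0 → L' → G → M → 0` starts the given resolution and `P → G` lifts `P → M`, then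
`0 → L → L' × P → G → 0` is exact. -/
theorem HasTotallyReflexiveResolution.syzygy [Module.Free R P] [Module.Finite R P] {n : ℕ}
    {i : L →ₗ[R] P} {f : P →ₗ[R] M} (h : IsShortExact i f)
    (hM : HasTotallyReflexiveResolution R (n + 1) M) : HasTotallyReflexiveResolution R n L := by
  obtain ⟨L', G, _, _, _, _, j, p, hL', hG, hp⟩ := hM
  obtain ⟨s, hs⟩ := Module.projective_lifting_property p f hp.surjective
  have hs' : ∀ x, p (s x) = f x := fun x => LinearMap.congr_fun hs x
  obtain ⟨α, hα⟩ := hp.exists_factor (-(s ∘ₗ i)) fun k => by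
    simp [hs', h.exact.apply_apply_eq_zero]
  refine HasTotallyReflexiveResolution.of_isShortExact
    (i := α.prod i) (f := j.coprod s) ⟨?_, ?_, ?_⟩ (hL'.prod isTotallyReflexive_of_free) hG
  · intro x y hxy
    exact h.injective (congrArg Prod.snd hxy)
  · rintro ⟨l, x⟩
    constructor
    · intro hlx
      have hlx' : j l + s x = 0 := by simpa using hlx
      have hx : f x = 0 := by
        have := congrArg p hlx'
        rwa [map_add, hp.exact.apply_apply_eq_zero, zero_add, hs', map_zero] at this
      obtain ⟨k, rfl⟩ := (h.exact x).mp hx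
      refine ⟨k, Prod.ext (hp.injective ?_) rfl⟩
      simpa [hα] using (eq_neg_of_add_eq_zero_left hlx').symm
    · rintro ⟨k, hk⟩
      rw [← hk]
      simp [hα]
  · intro g
    obtain ⟨x, hx⟩ := h.surjective (p g)
    have : p (g - s x) = 0 := by rw [map_sub, hs', hx, sub_self]
    obtain ⟨l, hl⟩ := (hp.exact _).mp this
    exact ⟨(l, x), by simp [hl]⟩

theorem HasTotallyReflexiveResolution.hasTotallyReflexiveSyzygy (hR : IsCoherentRing R) {n : ℕ} :
    ∀ {M : Type u} [AddCommGroup M] [Module R M] [Module.FinitePresentation R M],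
      HasTotallyReflexiveResolution R n M → HasTotallyReflexiveSyzygy R n M := by
  induction n with
  | zero =>
    intro M _ _ hfp hM
    exact ⟨hfp, hM⟩
  | succ n ih =>
    intro M _ _ _ hM
    obtain ⟨k, f, hf⟩ := Module.Finite.exists_fin' R M
    have := hR.finitePresentation_ker hf
    exact ⟨f.ker, Fin k → R, _, _, _, _, f.ker.subtype, f,
      ih (hM.syzygy (isShortExact_ker hf)), inferInstance, inferInstance, isShortExact_ker hf⟩

end TotallyReflexive

/-! ### Finite G-dimension -/

section GDimension

variable {R : Type u} [CommRing R]

theorem IsGClass.isTotallyReflexive {M : Type u} [AddCommGroup M] [Module R M]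
    (h : IsGClass R M) : IsTotallyReflexive R M :=
  ⟨h.ext_self, h.ext_dual, h.reflexive⟩

theorem exists_subsingleton_of_complexLength_lt_top {G : ChainComplex (ModuleCat.{u} R) ℕ}
    (h : complexLength G < ⊤) : ∃ N : ℕ, Subsingleton (G.X N) := by
  obtain ⟨N, hN⟩ := ENat.ne_top_iff_exists.mp h.ne
  refine ⟨N + 1, not_nontrivial_iff_subsingleton.mp fun hnt => ?_⟩
  have h1 : ((N + 1 : ℕ) : ℕ∞) ≤ complexLength G :=
    le_iSup₂_of_le (f := fun (i : ℕ) (_ : Nontrivial (G.X i)) => (i : ℕ∞)) (N + 1) hnt le_rfl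
  rw [← hN] at h1
  exact absurd (ENat.natCast_le_natCast.mp h1) (by omega)

/-- In an acyclic complex, `0 → coker d_{i+2} → G_i → coker d_{i+1} → 0` is exact. -/
theorem isShortExact_of_exactAt {G : ChainComplex (ModuleCat.{u} R) ℕ} {i : ℕ}
    (h : G.ExactAt (i + 1)) {M : Type u} [AddCommGroup M] [Module R M] {f : G.X i →ₗ[R] M}
    (hf : Function.Surjective f) (hker : (G.d (i + 1) i).hom.range = f.ker) :
    IsShortExact ((G.d (i + 2) (i + 1)).hom.range.liftQ (G.d (i + 1) i).hom (by
      rintro _ ⟨x, rfl⟩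
      exact congrArg (fun g => g.hom x) (G.d_comp_d (i + 2) (i + 1) i))) f := by
  refine ⟨?_, ?_, hf⟩
  · rw [← LinearMap.ker_eq_bot]
    refine Submodule.ker_liftQ_eq_bot _ _ _ fun x hx => ?_
    rw [HomologicalComplex.exactAt_iff' G (i + 2) (i + 1) i (ChainComplex.prev ℕ (i + 1))
      (by simp), ShortComplex.moduleCat_exact_iff] at h
    exact h x hx
  · rw [LinearMap.exact_iff, Submodule.range_liftQ, hker]

theorem hasTotallyReflexiveResolution_of_exactAt {G : ChainComplex (ModuleCat.{u} R) ℕ}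
    (hG : ∀ i, IsTotallyReflexive R (G.X i)) (hex : ∀ i, i ≠ 0 → G.ExactAt i) {N : ℕ}
    (hN : Subsingleton (G.X N)) (k : ℕ) :
    ∀ i, i + k = N → HasTotallyReflexiveResolution R k (G.X i ⧸ (G.d (i + 1) i).hom.range) := by
  induction k with
  | zero =>
    rintro i rfl
    have : Subsingleton (G.X i ⧸ (G.d (i + 1) i).hom.range) :=
      (Submodule.mkQ_surjective _).subsingleton (α := G.X i)
    exact isTotallyReflexive_of_free
  | succ k ih =>
    rintro i rfl
    exact ⟨_, G.X i, _, _, _, _, _, _, ih (i + 1) (by omega), hG i,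
      isShortExact_of_exactAt (hex _ i.succ_ne_zero) (Submodule.mkQ_surjective _)
        (Submodule.ker_mkQ _).symm⟩

theorem ker_pOpcycles_zero (G : ChainComplex (ModuleCat.{u} R) ℕ) (x : G.X 0) :
    (G.pOpcycles 0).hom x = 0 ↔ x ∈ (G.d 1 0).hom.range := by
  refine ((G.sc 0).moduleCat_pOpcycles_eq_zero_iff x).trans ?_
  have : ∀ j, j = 1 → (x ∈ (G.d j 0).hom.range ↔ x ∈ (G.d 1 0).hom.range) := by
    rintro j rfl
    rfl
  exact this _ (ChainComplex.prev ℕ 0)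

theorem exists_hasTotallyReflexiveResolution_of_gDim_lt_top {M : Type u} [AddCommGroup M]
    [Module R M] (h : gDim R M < ⊤) : ∃ n, HasTotallyReflexiveResolution R n M := by
  obtain ⟨G, h⟩ := iInf_lt_iff.mp h
  obtain ⟨hG, h⟩ := iInf_lt_iff.mp h
  obtain ⟨N, hN⟩ := exists_subsingleton_of_complexLength_lt_top h
  obtain ⟨e⟩ := hG.homology_zero
  let e' : G.opcycles 0 ≅ ModuleCat.of R M := G.isoHomologyι₀.symm ≪≫ e
  have hTR i := (hG.mem i).isTotallyReflexive
  have hf : Function.Surjective (G.pOpcycles 0 ≫ e'.hom).hom :=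
    (ModuleCat.epi_iff_surjective _).mp inferInstance
  have hker : (G.d 1 0).hom.range = (G.pOpcycles 0 ≫ e'.hom).hom.ker := by
    ext x
    rw [LinearMap.mem_ker, ← ker_pOpcycles_zero, ModuleCat.hom_comp, LinearMap.comp_apply]
    exact (map_eq_zero_iff _ e'.toLinearEquiv.injective).symm
  obtain ⟨⟩ | N := N
  · have hM : Subsingleton M := hf.subsingleton (α := G.X 0)
    exact ⟨0, isTotallyReflexive_of_free⟩
  · exact ⟨N + 1, _, G.X 0, _, _, _, _, _, _,
      hasTotallyReflexiveResolution_of_exactAt hTR hG.exact hN N 1 (by omega), hTR 0,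
      isShortExact_of_exactAt (hG.exact _ one_ne_zero) hf hker⟩

/-- Every finitely generated ideal has a finitely presented totally reflexive syzygy. Over a
coherent ring this expresses that finitely generated ideals have finite G-dimension, in a form that
passes to localizations. -/
def HasFiniteGDimension (R : Type u) [CommRing R] : Prop :=
  ∀ I : Ideal R, I.FG → ∃ n, HasTotallyReflexiveSyzygy R n I

theorem IsGorensteinLocalRing.hasFiniteGDimension [IsLocalRing R] (h : IsGorensteinLocalRing R)
    (hR : IsCoherentRing R) : HasFiniteGDimension R := by
  intro I hI
  obtain ⟨n, hn⟩ := exists_hasTotallyReflexiveResolution_of_gDim_lt_top (h I hI)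
  have := hR I hI
  exact ⟨n, hn.hasTotallyReflexiveSyzygy hR⟩

end GDimension

/-! ### Localization -/

section Localization

open TensorProduct

variable {R : Type u} [CommRing R] (T : Submonoid R) (A : Type u) [CommRing A] [Algebra R A]
  [IsLocalization T A]

variable {L P M L' P' M' : Type u} [AddCommGroup L] [Module R L] [AddCommGroup P] [Module R P]
  [AddCommGroup M] [Module R M]
  [AddCommGroup L'] [Module R L'] [Module A L'] [IsScalarTower R A L']
  [AddCommGroup P'] [Module R P'] [Module A P'] [IsScalarTower R A P']
  [AddCommGroup M'] [Module R M'] [Module A M'] [IsScalarTower R A M']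
  (gL : L →ₗ[R] L') [IsLocalizedModule T gL] (gP : P →ₗ[R] P') [IsLocalizedModule T gP]
  (gM : M →ₗ[R] M') [IsLocalizedModule T gM]

theorem linearMap_ext_of_isLocalizedModule (T : Submonoid R) (A : Type u) [CommRing A]
    [Algebra R A] [IsLocalization T A] [Module A P'] [IsScalarTower R A P'] [Module A M']
    [IsScalarTower R A M'] (gM : M →ₗ[R] M') [IsLocalizedModule T gM]
    {φ ψ : M' →ₗ[A] P'} (h : ∀ m, φ (gM m) = ψ (gM m)) :
    φ = ψ := by
  refine LinearMap.restrictScalars_injective R (IsLocalizedModule.ext T gM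
    (fun s => ?_) (LinearMap.ext h))
  rw [Module.End.isUnit_iff]
  obtain ⟨u, hu⟩ := IsLocalization.map_units A s
  convert (LinearEquiv.smulOfUnit u : P' ≃ₗ[A] P').bijective using 1
  refine funext fun x => ?_
  change (s : R) • x = (u : A) • x
  rw [hu, algebraMap_smul]

/-- A localized linear map, as a map linear over the localized ring. -/
noncomputable abbrev localizedMap (f : M →ₗ[R] P) : M' →ₗ[A] P' :=
  IsLocalizedModule.mapExtendScalars T gM gP A f

theorem localizedMap_apply (f : M →ₗ[R] P) (m : M) :
    localizedMap T A gP gM f (gM m) = gP (f m) :=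
  IsLocalizedModule.map_apply T gM gP f m

theorem IsShortExact.localized {i : L →ₗ[R] P} {f : P →ₗ[R] M} (h : IsShortExact i f) :
    IsShortExact (localizedMap T A gP gL i) (localizedMap T A gM gP f) :=
  ⟨IsLocalizedModule.map_injective T gL gP i h.injective,
    IsLocalizedModule.map_exact T gL gP gM i f h.exact,
    IsLocalizedModule.map_surjective T gP gM f h.surjective⟩

/-- The localization map on dual modules. -/
noncomputable abbrev localizedDual : Module.Dual R M →ₗ[R] Module.Dual A M' :=
  IsLocalizedModule.mapExtendScalars T gM (Algebra.linearMap R A) A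

theorem localizedDual_apply (φ : Module.Dual R M) (m : M) :
    localizedDual T A gM φ (gM m) = algebraMap R A (φ m) :=
  IsLocalizedModule.map_apply T gM (Algebra.linearMap R A) φ m

theorem localizedDual_comp (i : L →ₗ[R] P) (φ : Module.Dual R P) :
    localizedDual T A gL (φ ∘ₗ i) = localizedDual T A gP φ ∘ₗ localizedMap T A gP gL i := by
  refine linearMap_ext_of_isLocalizedModule T A gL fun m => ?_
  rw [localizedDual_apply]
  change _ = localizedDual T A gP φ (localizedMap T A gP gL i (gL m))
  rw [localizedMap_apply, localizedDual_apply, LinearMap.comp_apply]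

theorem exists_localizedDual_eq_smul [Module.FinitePresentation R M] (φ : Module.Dual A M') :
    ∃ (s : T) (ψ : Module.Dual R M), localizedDual T A gM ψ = (s : R) • φ := by
  obtain ⟨⟨ψ, s⟩, h⟩ := IsLocalizedModule.surj T (localizedDual T A gM) φ
  exact ⟨s, ψ, h.symm⟩

theorem exists_smul_eq_of_isLocalization (T : Submonoid R) (A : Type u) [CommRing A] [Algebra R A]
    [IsLocalization T A] {N : Type*} [AddCommGroup N] [Module R N] [Module A N]
    [IsScalarTower R A N] (s : T) (x : N) : ∃ y : N, (s : R) • y = x := by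
  obtain ⟨u, hu⟩ := IsLocalization.map_units A s
  refine ⟨(↑u⁻¹ : A) • x, ?_⟩
  rw [← algebraMap_smul A (s : R), ← hu, smul_smul, Units.mul_inv, one_smul]

theorem smul_cancel_of_isLocalization (T : Submonoid R) (A : Type u) [CommRing A] [Algebra R A]
    [IsLocalization T A] {N : Type*} [AddCommGroup N] [Module R N] [Module A N]
    [IsScalarTower R A N] (s : T) {x y : N} (h : (s : R) • x = (s : R) • y) : x = y := by
  obtain ⟨u, hu⟩ := IsLocalization.map_units A s
  rw [← algebraMap_smul A (s : R) x, ← algebraMap_smul A (s : R) y, ← hu] at h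
  have := congrArg (fun z => (↑u⁻¹ : A) • z) h
  simpa only [smul_smul, Units.inv_mul, one_smul] using this

theorem exists_extend_localized [Module.FinitePresentation R L] {i : L →ₗ[R] P}
    (h : ∀ φ : Module.Dual R L, ∃ ψ : Module.Dual R P, ψ ∘ₗ i = φ) (φ : Module.Dual A L') :
    ∃ ψ : Module.Dual A P', ψ ∘ₗ localizedMap T A gP gL i = φ := by
  obtain ⟨s, φ₀, hφ₀⟩ := exists_localizedDual_eq_smul T A gL φ
  obtain ⟨ψ₀, rfl⟩ := h φ₀
  obtain ⟨ψ, hψ⟩ := exists_smul_eq_of_isLocalization T A s (localizedDual T A gP ψ₀)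
  refine ⟨ψ, smul_cancel_of_isLocalization T A s ?_⟩
  rw [← hφ₀, localizedDual_comp T A gL gP, ← hψ]
  rfl

theorem subsingleton_ext_localized (T : Submonoid R) (A : Type u) [CommRing A]
    [Algebra R A] [IsLocalization T A] (hR : IsCoherentRing R) (n : ℕ) :
    ∀ {M M' : Type u} [AddCommGroup M] [Module R M] [AddCommGroup M'] [Module R M']
      [Module A M'] [IsScalarTower R A M'] (gM : M →ₗ[R] M') [IsLocalizedModule T gM]
      [Module.FinitePresentation R M], Subsingleton (ModExt R M R (n + 1)) →
      Subsingleton (ModExt A M' A (n + 1)) := by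
  induction n with
  | zero =>
    intro M M' _ _ _ _ _ _ gM _ _ hM
    obtain ⟨k, f, hf⟩ := Module.Finite.exists_fin' R M
    have := hR.finitePresentation_ker hf
    have hs := isShortExact_ker hf
    refine (hs.localized T A (TensorProduct.mk R A f.ker 1) (TensorProduct.mk R A (Fin k → R) 1)
      gM).subsingleton_ext_one (subsingleton_ext_of_projective 0) ?_
    exact exists_extend_localized T A _ _ (hs.exists_extend hM)
  | succ n ih =>
    intro M M' _ _ _ _ _ _ gM _ _ hM
    obtain ⟨k, f, hf⟩ := Module.Finite.exists_fin' R M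
    have := hR.finitePresentation_ker hf
    have hs := isShortExact_ker hf
    exact (hs.localized T A (TensorProduct.mk R A f.ker 1) (TensorProduct.mk R A (Fin k → R) 1)
      gM).subsingleton_ext_right (ih (TensorProduct.mk R A f.ker 1)
        (hs.subsingleton_ext_left (subsingleton_ext_of_projective n) hM))
      (subsingleton_ext_of_projective _)

/-- If the localized `Ext` vanishes, then each class in `Ext` is killed by an element of the
multiplicative set. -/
theorem exists_smul_eq_zero_of_subsingleton_ext_localized (T : Submonoid R) (A : Type u)
    [CommRing A] [Algebra R A] [IsLocalization T A] (hR : IsCoherentRing R) (n : ℕ) :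
    ∀ {M M' : Type u} [AddCommGroup M] [Module R M] [AddCommGroup M'] [Module R M']
      [Module A M'] [IsScalarTower R A M'] (gM : M →ₗ[R] M') [IsLocalizedModule T gM]
      [Module.FinitePresentation R M], Subsingleton (ModExt A M' A (n + 1)) →
      ∀ ξ : ModExt R M R (n + 1), ∃ s ∈ T, s • ξ = 0 := by
  induction n with
  | zero =>
    intro M M' _ _ _ _ _ _ gM _ _ hM ξ
    obtain ⟨k, f, hf⟩ := Module.Finite.exists_fin' R M
    have := hR.finitePresentation_ker hf
    have hs := isShortExact_ker hf
    let gK := TensorProduct.mk R A f.ker 1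
    let gP := TensorProduct.mk R A (Fin k → R) 1
    obtain ⟨η, rfl⟩ := hs.exists_comp_extClass (subsingleton_ext_of_projective 0) ξ
    obtain ⟨φ, rfl⟩ := (Abelian.Ext.mk₀_bijective _ _).surjective η
    obtain ⟨ψ', hψ'⟩ := (hs.localized T A gK gP gM).exists_extend hM
      (localizedDual T A gK φ.hom)
    obtain ⟨s, ψ, hψ⟩ := exists_localizedDual_eq_smul T A gP ψ'
    have h1 : localizedDual T A gK (ψ ∘ₗ f.ker.subtype) =
        localizedDual T A gK ((s : R) • φ.hom) := by
      rw [localizedDual_comp T A gK gP, hψ, map_smul, ← hψ']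
      rfl
    obtain ⟨t, ht⟩ := (IsLocalizedModule.eq_iff_exists T (localizedDual T A gK)).mp h1
    refine ⟨t * s, (t * s).2, ?_⟩
    rw [← Abelian.Ext.comp_smul, ← Abelian.Ext.mk₀_smul]
    have h2 : (((t : R) * (s : R)) • φ) =
        ModuleCat.ofHom (((t : R) • ψ) ∘ₗ f.ker.subtype) := by
      refine ModuleCat.hom_ext ?_
      rw [mul_smul]
      exact ht.symm
    rw [h2]
    exact hs.extClass_comp_eq_zero _
  | succ n ih =>
    intro M M' _ _ _ _ _ _ gM _ _ hM ξ
    obtain ⟨k, f, hf⟩ := Module.Finite.exists_fin' R M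
    have := hR.finitePresentation_ker hf
    have hs := isShortExact_ker hf
    let gK := TensorProduct.mk R A f.ker 1
    let gP := TensorProduct.mk R A (Fin k → R) 1
    obtain ⟨η, rfl⟩ := hs.exists_comp_extClass (subsingleton_ext_of_projective _) ξ
    obtain ⟨s, hs', h0⟩ := ih gK ((hs.localized T A gK gP gM).subsingleton_ext_left
      (subsingleton_ext_of_projective n) hM) η
    exact ⟨s, hs', by rw [← Abelian.Ext.comp_smul, h0, Abelian.Ext.comp_zero]⟩

theorem finitePresentation_localized (T : Submonoid R) (A : Type u) [CommRing A] [Algebra R A]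
    [IsLocalization T A] [Module A M'] [IsScalarTower R A M'] (gM : M →ₗ[R] M')
    [IsLocalizedModule T gM] [Module.FinitePresentation R M] :
    Module.FinitePresentation A M' :=
  FinitePresentation.of_isBaseChange gM ((isLocalizedModule_iff_isBaseChange T A gM).mp
    inferInstance)

theorem exists_fg_map_eq (T : Submonoid R) (A : Type u) [CommRing A] [Algebra R A]
    [IsLocalization T A] (J : Ideal A) (hJ : J.FG) :
    ∃ I : Ideal R, I.FG ∧ I.map (algebraMap R A) = J := by
  induction J, hJ using Submodule.fg_induction with
  | singleton x =>
    obtain ⟨⟨r, t⟩, h⟩ := IsLocalization.surj T x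
    obtain ⟨u, hu⟩ := IsLocalization.map_units A t
    refine ⟨Ideal.span {r}, ⟨{r}, by simp⟩, ?_⟩
    rw [Ideal.map_span, Set.image_singleton, ← h, ← hu]
    exact Ideal.span_singleton_mul_right_unit u.isUnit x
  | sup J₁ J₂ _ _ h₁ h₂ =>
    obtain ⟨I₁, h₁, rfl⟩ := h₁
    obtain ⟨I₂, h₂, rfl⟩ := h₂
    exact ⟨I₁ ⊔ I₂, Submodule.FG.sup h₁ h₂, Ideal.map_sup _ _ _⟩

theorem IsCoherentRing.localized (T : Submonoid R) (A : Type u) [CommRing A] [Algebra R A]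
    [IsLocalization T A] (hR : IsCoherentRing R) : IsCoherentRing A := by
  intro J hJ
  obtain ⟨I, hI, rfl⟩ := exists_fg_map_eq T A J hJ
  have := hR I hI
  exact finitePresentation_localized T A (Algebra.idealMap A I)

theorem IsTotallyReflexive.localized (T : Submonoid R) (A : Type u) [CommRing A] [Algebra R A]
    [IsLocalization T A] [Module A M'] [IsScalarTower R A M'] (gM : M →ₗ[R] M')
    [IsLocalizedModule T gM] (hR : IsCoherentRing R) [Module.FinitePresentation R M]
    (hM : IsTotallyReflexive R M) : IsTotallyReflexive A M' := by
  have := hR.finitePresentation_dual (M := M)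
  have hdual : ExtVanishes A (Module.Dual A M') := extVanishes_of_succ fun n =>
    subsingleton_ext_localized T A hR n (localizedDual T A gM) (hM.ext_dual.succ n)
  refine ⟨extVanishes_of_succ fun n => subsingleton_ext_localized T A hR n gM (hM.ext_self.succ n),
    hdual, ?_⟩
  have h : Module.Dual.eval A M' = localizedMap T A
      (localizedDual T A (localizedDual T A gM)) gM (Module.Dual.eval R M) := by
    refine linearMap_ext_of_isLocalizedModule T A gM fun m => ?_
    rw [localizedMap_apply]
    refine linearMap_ext_of_isLocalizedModule T A (localizedDual T A gM) fun φ => ?_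
    rw [localizedDual_apply, Module.Dual.eval_apply, localizedDual_apply, Module.Dual.eval_apply]
  rw [h]
  exact ⟨IsLocalizedModule.map_injective T _ _ _ hM.reflexive.1,
    IsLocalizedModule.map_surjective T _ _ _ hM.reflexive.2⟩

theorem HasTotallyReflexiveSyzygy.localized (T : Submonoid R) (A : Type u) [CommRing A]
    [Algebra R A] [IsLocalization T A] (hR : IsCoherentRing R) {n : ℕ} :
    ∀ {M M' : Type u} [AddCommGroup M] [Module R M] [AddCommGroup M'] [Module R M']
      [Module A M'] [IsScalarTower R A M'] (gM : M →ₗ[R] M') [IsLocalizedModule T gM],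
      HasTotallyReflexiveSyzygy R n M → HasTotallyReflexiveSyzygy A n M' := by
  induction n with
  | zero =>
    rintro M M' _ _ _ _ _ _ gM _ ⟨hfp, hM⟩
    exact ⟨finitePresentation_localized T A gM, hM.localized T A gM hR⟩
  | succ n ih =>
    rintro M M' _ _ _ _ _ _ gM _ ⟨L, P, _, _, _, _, i, f, hL, hfree, hfin, h⟩
    exact ⟨A ⊗[R] L, A ⊗[R] P, _, _, _, _, _, _, ih (TensorProduct.mk R A L 1) hL,
      inferInstance, inferInstance, h.localized T A (TensorProduct.mk R A L 1)
        (TensorProduct.mk R A P 1) gM⟩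

theorem HasFiniteGDimension.localized (T : Submonoid R) (A : Type u) [CommRing A] [Algebra R A]
    [IsLocalization T A] (hR : IsCoherentRing R) (h : HasFiniteGDimension R) :
    HasFiniteGDimension A := by
  intro J hJ
  obtain ⟨I, hI, rfl⟩ := exists_fg_map_eq T A J hJ
  obtain ⟨n, hn⟩ := h I hI
  exact ⟨n, hn.localized T A hR (Algebra.idealMap A I)⟩

end Localization

/-! ### Weakly regular sequences and the Auslander–Bridger bound -/

section RegularSequence

open RingTheory.Sequence Pointwise

variable {R : Type u} [CommRing R] {L P M N Q : Type u} [AddCommGroup L] [Module R L]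
  [AddCommGroup P] [Module R P] [AddCommGroup M] [Module R M] [AddCommGroup N] [Module R N]
  [AddCommGroup Q] [Module R Q]

/-- If `rs` is weakly regular on `M`, then `L ∩ (rs)P = (rs)L`. -/
theorem IsShortExact.mem_smul_top_of_isWeaklyRegular {i : L →ₗ[R] P} {f : P →ₗ[R] M}
    (h : IsShortExact i f) {rs : List R} (hM : IsWeaklyRegular M rs) {l : L}
    (hl : i l ∈ Ideal.ofList rs • (⊤ : Submodule R P)) :
    l ∈ Ideal.ofList rs • (⊤ : Submodule R L) := by
  have h0 : Function.Exact (0 : PUnit.{u + 1} →ₗ[R] L) i :=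
    (LinearMap.exact_zero_iff_injective _ _).mpr h.injective
  have := map_first_exact_on_four_term_right_exact_of_isSMulRegular_last h0 h.exact h.surjective hM
  obtain ⟨y, hy⟩ := (this (Submodule.Quotient.mk l)).mp
    ((Submodule.Quotient.mk_eq_zero _).mpr hl)
  obtain ⟨y, rfl⟩ := Submodule.Quotient.mk_surjective _ y
  exact (Submodule.Quotient.mk_eq_zero _).mp hy.symm

theorem isWeaklyRegular_take {rs : List R} (h : IsWeaklyRegular M rs) (j : ℕ) :
    IsWeaklyRegular M (rs.take j) := by
  rw [← List.take_append_drop j rs, isWeaklyRegular_append_iff'] at h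
  exact h.1

theorem isWeaklyRegular_of_free [Module.Free R P] {rs : List R} (h : IsWeaklyRegular R rs) :
    IsWeaklyRegular P rs :=
  ((TensorProduct.rid R P).isWeaklyRegular_congr rs).mp h.isWeaklyRegular_lTensor

/-- A syzygy of a module on which `j` elements of the sequence form a weakly regular sequence
gains one element. -/
theorem IsShortExact.isWeaklyRegular_take_succ {i : L →ₗ[R] P} {f : P →ₗ[R] M}
    (h : IsShortExact i f) {rs : List R} {j : ℕ} (hP : IsWeaklyRegular P rs)
    (hM : IsWeaklyRegular M (rs.take j)) : IsWeaklyRegular L (rs.take (j + 1)) := by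
  refine ⟨fun k hk => ?_⟩
  rw [List.length_take] at hk
  rw [isSMulRegular_quotient_iff_mem_of_smul_mem]
  intro l hl
  have hk' : k < rs.length := by omega
  have h1 : (rs.take (j + 1)).take k = rs.take k := by
    rw [List.take_take, min_eq_left (by omega)]
  have h2 : IsWeaklyRegular M (rs.take k) := by
    have := isWeaklyRegular_take hM k
    rwa [List.take_take, min_eq_left (by omega)] at this
  rw [List.getElem_take] at hl
  rw [h1] at hl ⊢
  refine h.mem_smul_top_of_isWeaklyRegular h2 ?_
  refine (isSMulRegular_quotient_iff_mem_of_smul_mem _ _).mp (hP.regular_mod_prev k hk') _ ?_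
  rw [← map_smul]
  have := Submodule.mem_map_of_mem (f := i) hl
  rw [Submodule.map_smul''] at this
  exact Submodule.smul_mono le_rfl le_top this

theorem isShortExact_smul {r : R} (hr : IsSMulRegular N r) :
    IsShortExact (LinearMap.lsmul R N r) (r • (⊤ : Submodule R N)).mkQ := by
  refine ⟨hr, ?_, Submodule.mkQ_surjective _⟩
  rw [LinearMap.exact_iff, Submodule.ker_mkQ]
  ext x
  simp [Submodule.mem_smul_pointwise_iff_exists]

/-- If `Ext^n(M, N) = 0` for all `n > 0` and `rs` is weakly regular on `N`, then maps from `M` to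
`N / (rs)N` lift to `N`. -/
theorem exists_lift_of_isWeaklyRegular {rs : List R} :
    ∀ {N Q : Type u} [AddCommGroup N] [Module R N] [AddCommGroup Q] [Module R Q],
      IsWeaklyRegular N rs → (∀ n, Subsingleton (ModExt R M N (n + 1))) →
      ∀ q : N →ₗ[R] Q, Function.Surjective q → q.ker = Ideal.ofList rs • ⊤ →
      ∀ φ : M →ₗ[R] Q, ∃ ψ : M →ₗ[R] N, q ∘ₗ ψ = φ := by
  induction rs with
  | nil =>
    intro N Q _ _ _ _ _ _ q hq hker φ
    rw [Ideal.ofList_nil, Submodule.bot_smul, LinearMap.ker_eq_bot] at hker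
    let e := LinearEquiv.ofBijective q ⟨hker, hq⟩
    exact ⟨e.symm.toLinearMap ∘ₗ φ, LinearMap.ext fun x => e.apply_symm_apply (φ x)⟩
  | cons r rs ih =>
    intro N Q _ _ _ _ hN hExt q hq hker φ
    rw [isWeaklyRegular_cons_iff] at hN
    rw [Ideal.ofList_cons_smul] at hker
    have hs := isShortExact_smul hN.1
    have hle : r • (⊤ : Submodule R N) ≤ q.ker := hker ▸ le_sup_left
    obtain ⟨ψ₁, hψ₁⟩ := ih (N := QuotSMulTop r N) hN.2
      (fun n => hs.subsingleton_ext_covariant (hExt n) (hExt (n + 1)))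
      ((r • (⊤ : Submodule R N)).liftQ q hle)
      (fun y => (hq y).imp' _ fun x hx => (Submodule.liftQ_apply _ _ x).trans hx)
      (by
        rw [Submodule.ker_liftQ, hker, Submodule.map_sup, Submodule.map_smul'', Submodule.map_top,
          Submodule.range_mkQ, Submodule.mkQ_map_self, bot_sup_eq]) φ
    obtain ⟨ψ, rfl⟩ := hs.exists_lift (hExt 0) ψ₁
    refine ⟨ψ, ?_⟩
    rw [← hψ₁, ← LinearMap.comp_assoc, Submodule.liftQ_mkQ]

/-- `R/I` has depth zero: it contains a nonzero element killed by `J`, for each finitely generated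
proper ideal `J`. For a local ring, these are the finitely generated `J` inside the maximal
ideal. -/
def IsDepthZeroQuotient (I : Ideal R) : Prop :=
  ∀ J : Ideal R, J.FG → J ≠ ⊤ → ∃ c ∉ I, ∀ a ∈ J, a * c ∈ I

theorem IsDepthZeroQuotient.exists_ne_zero_of_span {I : Ideal R} (hI : IsDepthZeroQuotient I)
    (n : ℕ) : ∀ {X : Type u} [AddCommGroup X] [Module R X] [Module.FinitePresentation R X]
      [Nontrivial X] (v : Fin n → X), Submodule.span R (Set.range v) = ⊤ →
      ∃ h : X →ₗ[R] R ⧸ I, h ≠ 0 := by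
  induction n with
  | zero =>
    intro X _ _ _ _ v hv
    rw [Set.range_eq_empty, Submodule.span_empty] at hv
    exact absurd hv bot_ne_top
  | succ n ih =>
    intro X _ _ _ _ v hv
    let Y := Submodule.span R {v 0}
    have hY : Y.FG := ⟨{v 0}, by simp [Y]⟩
    obtain hnt | hss := (subsingleton_or_nontrivial (X ⧸ Y)).symm
    · have : Module.FinitePresentation R (X ⧸ Y) :=
        Module.finitePresentation_of_surjective Y.mkQ Y.mkQ_surjective (by rwa [Submodule.ker_mkQ])
      obtain ⟨h, hh⟩ := ih (fun j : Fin n => Y.mkQ (v j.succ)) (by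
        rw [eq_top_iff, ← Submodule.range_mkQ Y, ← Submodule.map_top, ← hv, Submodule.map_span,
          Submodule.span_le]
        rintro _ ⟨_, ⟨j, rfl⟩, rfl⟩
        refine Fin.cases ?_ (fun j => ?_) j
        · rw [(Submodule.Quotient.mk_eq_zero Y).mpr (Submodule.mem_span_singleton_self _) |>
            (show Y.mkQ (v 0) = 0 from ·)]
          exact Submodule.zero_mem _
        · exact Submodule.subset_span ⟨j, rfl⟩)
      refine ⟨h ∘ₗ Y.mkQ, fun h0 => hh ?_⟩
      rwa [← LinearMap.zero_comp Y.mkQ, LinearMap.cancel_right Y.mkQ_surjective] at h0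
    · -- `X` is cyclic, isomorphic to `R/J` with `J` finitely generated.
      have hsurj : Function.Surjective (LinearMap.toSpanSingleton R X (v 0)) := by
        rw [← LinearMap.range_eq_top, LinearMap.range_toSpanSingleton]
        exact Submodule.Quotient.subsingleton_iff.mp hss
      let f := LinearMap.toSpanSingleton R X (v 0)
      obtain ⟨c, hc, hcJ⟩ := hI f.ker (Module.FinitePresentation.fg_ker f hsurj) (by
        intro htop
        rw [LinearMap.ker_eq_top] at htop
        obtain ⟨x, hx⟩ := exists_ne (0 : X)
        obtain ⟨r, rfl⟩ := hsurj x
        exact hx (LinearMap.congr_fun htop r))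
      let g : R →ₗ[R] R ⧸ I := LinearMap.toSpanSingleton R (R ⧸ I) (Submodule.Quotient.mk c)
      have hle : f.ker ≤ g.ker := fun a ha =>
        (Submodule.Quotient.mk_eq_zero I).mpr (hcJ a ha)
      refine ⟨f.ker.liftQ g hle ∘ₗ (f.quotKerEquivOfSurjective hsurj).symm.toLinearMap,
        fun h0 => hc ?_⟩
      have h1 : (f.quotKerEquivOfSurjective hsurj).symm (f 1) = Submodule.Quotient.mk 1 := by
        rw [LinearEquiv.symm_apply_eq]; rfl
      have h2 := LinearMap.congr_fun h0 (f 1)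
      rw [LinearMap.comp_apply, LinearEquiv.coe_coe, h1] at h2
      have h3 : (Submodule.Quotient.mk c : R ⧸ I) = 0 := by
        have h4 : g 1 = 0 := h2
        rwa [LinearMap.toSpanSingleton_apply, one_smul] at h4
      exact (Submodule.Quotient.mk_eq_zero I).mp h3

/-- Over a ring with a depth zero quotient `R/I`, nonzero finitely presented modules have nonzero
maps to `R/I`. -/
theorem IsDepthZeroQuotient.subsingleton {I : Ideal R} (hI : IsDepthZeroQuotient I)
    {X : Type u} [AddCommGroup X] [Module R X] [Module.FinitePresentation R X]
    (hX : ∀ h : X →ₗ[R] R ⧸ I, h = 0) : Subsingleton X := by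
  by_contra hne
  have := not_subsingleton_iff_nontrivial.mp hne
  obtain ⟨n, v, hv⟩ := Module.Finite.exists_fin (R := R) (M := X)
  obtain ⟨h, hh⟩ := hI.exists_ne_zero_of_span n v hv
  exact hh (hX h)

theorem apply_mem_of_mem_smul_top {I : Ideal R} (φ : Module.Dual R M) {x : M}
    (hx : x ∈ I • (⊤ : Submodule R M)) : φ x ∈ I := by
  refine Submodule.smul_induction_on hx (fun r hr m _ => ?_) fun x y hx hy => ?_
  · rw [map_smul, smul_eq_mul]
    exact I.mul_mem_right _ hr
  · rw [map_add]
    exact I.add_mem hx hy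

/-- The step of the Auslander–Bridger argument: a module on which the sequence is weakly regular
and whose first syzygy is totally reflexive is itself totally reflexive, if the quotient by the
sequence has depth zero. The obstruction is the cokernel of `P^* → L^*`; a map from it to
`R/(rs)` is the reduction of evaluation at an element of `L ∩ (rs)P = (rs)L`, hence zero. -/
theorem IsShortExact.isTotallyReflexive_of_isDepthZeroQuotient (hR : IsCoherentRing R)
    {rs : List R} (hrs : IsWeaklyRegular R rs) (hI : IsDepthZeroQuotient (Ideal.ofList rs))
    {i : L →ₗ[R] P} {f : P →ₗ[R] M} (h : IsShortExact i f) [Module.Free R P] [Module.Finite R P]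
    [Module.FinitePresentation R L] (hL : IsTotallyReflexive R L) (hM : IsWeaklyRegular M rs) :
    IsTotallyReflexive R M := by
  refine h.isTotallyReflexive_right hL isTotallyReflexive_of_free ?_
  have := hR.finitePresentation_dual (M := L)
  have : Module.FinitePresentation R (Module.Dual R L ⧸ i.dualMap.range) :=
    Module.finitePresentation_of_surjective _ (Submodule.mkQ_surjective _)
      (by rw [Submodule.ker_mkQ]; exact Module.Finite.iff_fg.mp inferInstance)
  have hX : Subsingleton (Module.Dual R L ⧸ i.dualMap.range) := by
    refine hI.subsingleton fun g => ?_
    obtain ⟨ψ, hψ⟩ := exists_lift_of_isWeaklyRegular hrs hL.ext_dual.succ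
      (Ideal.ofList rs).mkQ (Submodule.mkQ_surjective _)
      (by rw [Submodule.ker_mkQ, smul_eq_mul, Ideal.mul_top]) (g ∘ₗ Submodule.mkQ _)
    obtain ⟨l, rfl⟩ := hL.reflexive.2 ψ
    have hval : ∀ φ : Module.Dual R L, g (Submodule.Quotient.mk φ) =
        (Submodule.Quotient.mk (φ l) : R ⧸ Ideal.ofList rs) := fun φ =>
      (LinearMap.congr_fun hψ φ).symm
    have hP : ∀ φ : Module.Dual R P, φ (i l) ∈ Ideal.ofList rs := fun φ => by
      rw [← Submodule.Quotient.mk_eq_zero (Ideal.ofList rs)]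
      have h1 := hval (i.dualMap φ)
      rw [(Submodule.Quotient.mk_eq_zero _).mpr (LinearMap.mem_range_self _ φ), map_zero] at h1
      exact h1.symm
    have hil : i l ∈ Ideal.ofList rs • (⊤ : Submodule R P) := by
      let b := Module.Free.chooseBasis R P
      rw [← b.sum_repr (i l)]
      exact Submodule.sum_mem _ fun j _ =>
        Submodule.smul_mem_smul (hP (b.coord j)) Submodule.mem_top
    have hl := h.mem_smul_top_of_isWeaklyRegular hM hil
    refine LinearMap.ext fun x => ?_
    obtain ⟨φ, rfl⟩ := Submodule.Quotient.mk_surjective _ x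
    rw [hval, LinearMap.zero_apply, Submodule.Quotient.mk_eq_zero]
    exact apply_mem_of_mem_smul_top φ hl
  exact LinearMap.range_eq_top.mp (Submodule.Quotient.subsingleton_iff.mp hX)

theorem HasTotallyReflexiveSyzygy.isTotallyReflexive (hR : IsCoherentRing R)
    {rs : List R} (hrs : IsWeaklyRegular R rs) (hI : IsDepthZeroQuotient (Ideal.ofList rs))
    {n : ℕ} : ∀ {M : Type u} [AddCommGroup M] [Module R M], HasTotallyReflexiveSyzygy R n M →
      IsWeaklyRegular M rs → Module.FinitePresentation R M ∧ IsTotallyReflexive R M := by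
  induction n with
  | zero => exact fun hM _ => hM
  | succ n ih =>
    rintro M _ _ ⟨L, P, _, _, _, _, i, f, hL, _, _, h⟩ hM
    have hL' : IsWeaklyRegular L rs := by
      have := h.isWeaklyRegular_take_succ (j := rs.length) (isWeaklyRegular_of_free hrs)
        (by rwa [List.take_length])
      rwa [List.take_of_length_le (by omega)] at this
    obtain ⟨hfp, hTR⟩ := ih hL hL'
    have := Module.finitePresentation_of_projective R P
    refine ⟨Module.finitePresentation_of_surjective f h.surjective ?_,
      h.isTotallyReflexive_of_isDepthZeroQuotient hR hrs hI hTR hM⟩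
    rw [h.exact.linearMap_ker_eq]
    exact Module.Finite.iff_fg.mp inferInstance

theorem HasTotallyReflexiveSyzygy.subsingleton_ext (hR : IsCoherentRing R)
    {rs : List R} (hrs : IsWeaklyRegular R rs) (hI : IsDepthZeroQuotient (Ideal.ofList rs))
    (j : ℕ) : ∀ {n : ℕ} {M : Type u} [AddCommGroup M] [Module R M],
      HasTotallyReflexiveSyzygy R n M → IsWeaklyRegular M (rs.take (rs.length - j)) →
      ∀ k, Subsingleton (ModExt R M R (j + k + 1)) := by
  induction j with
  | zero =>
    intro n M _ _ hM hreg k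
    rw [Nat.sub_zero, List.take_length] at hreg
    exact (hM.isTotallyReflexive hR hrs hI hreg).2.ext_self.succ _
  | succ j ih =>
    intro n M _ _ hM hreg k
    obtain ⟨⟩ | n := n
    · exact hM.2.ext_self.succ _
    · obtain ⟨L, P, _, _, _, _, i, f, hL, _, _, h⟩ := hM
      have hL' : IsWeaklyRegular L (rs.take (rs.length - j)) := by
        have := isWeaklyRegular_take
          (h.isWeaklyRegular_take_succ (isWeaklyRegular_of_free hrs) hreg) (rs.length - j)
        rwa [List.take_take, min_eq_left (by omega)] at this
      have := h.subsingleton_ext_right (ih hL hL' k) (subsingleton_ext_of_projective _)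
      rwa [show j + 1 + k = j + k + 1 by omega]

/-- The Auslander–Bridger bound: if `rs` is a weakly regular sequence of length `d` and `R/(rs)`
has depth zero, then `Ext^{d+1}(M, R)` vanishes for cyclic finitely presented modules `M`. -/
theorem HasFiniteGDimension.subsingleton_ext (hR : IsCoherentRing R) (hG : HasFiniteGDimension R)
    {rs : List R} (hrs : IsWeaklyRegular R rs) (hI : IsDepthZeroQuotient (Ideal.ofList rs))
    [Module.FinitePresentation R M] (f : R →ₗ[R] M) (hf : Function.Surjective f) :
    Subsingleton (ModExt R M R (rs.length + 1)) := by
  obtain ⟨n, hn⟩ := hG f.ker (Module.FinitePresentation.fg_ker f hf)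
  have hM : HasTotallyReflexiveSyzygy R (n + 1) M :=
    ⟨f.ker, R, _, _, _, _, f.ker.subtype, f, hn, inferInstance, inferInstance, isShortExact_ker hf⟩
  have := hM.subsingleton_ext hR hrs hI rs.length
    (by rw [Nat.sub_self, List.take_zero]; exact IsWeaklyRegular.nil R M) 0
  rwa [Nat.add_zero] at this

end RegularSequence

/-! ### Local cohomology and strong parameter sequences -/

section LocalCohomology

variable {R : Type u} [CommRing R]

/-- If every class in `Ext^{n+1}(R/I^t, N)`, for every `t`, is killed by an element of `T`, then so
is every element of the local cohomology module `H^{n+1}_I(N)`: for an injective resolution `E`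
of `N`, a cocycle of `E` killed by `I^t` is a map from `R/I^t`, hence represents such a class. -/
theorem exists_smul_eq_zero_localCohomology (T : Submonoid R) (I : Ideal R) (N : ModuleCat.{u} R)
    (n : ℕ) (hT : ∀ (t : ℕ) (ξ : Abelian.Ext (ModuleCat.of R (R ⧸ I ^ t)) N (n + 1)),
      ∃ s ∈ T, s • ξ = 0) (y : (localCohomologyFunctor I (n + 1)).obj N) :
    ∃ s ∈ T, s • y = 0 := by
  let E := injectiveResolution N
  let K := ((torsionFunctor I).mapHomologicalComplex (ComplexShape.up ℕ)).obj E.cocomplex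
  let e : (localCohomologyFunctor I (n + 1)).obj N ≅ K.homology (n + 1) :=
    E.isoRightDerivedObj (torsionFunctor I) (n + 1)
  obtain ⟨z, hz⟩ := (ModuleCat.epi_iff_surjective (K.homologyπ (n + 1))).mp inferInstance
    (e.hom.hom y)
  let w : idealTorsion I (E.cocomplex.X (n + 1)) := (K.iCycles (n + 1)).hom z
  have hw : (E.cocomplex.d (n + 1) (n + 2)).hom w.1 = 0 := by
    have h := congrArg (fun g => g.hom z) (K.iCycles_d (n + 1) (n + 2))
    exact congrArg Subtype.val h
  obtain ⟨t, ht⟩ := w.2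
  let g₀ : (R ⧸ I ^ t) →ₗ[R] E.cocomplex.X (n + 1) :=
    (I ^ t).liftQ (LinearMap.toSpanSingleton R _ w.1) fun a ha => ht a ha
  let g : ModuleCat.of R (R ⧸ I ^ t) ⟶ E.cocomplex.X (n + 1) := ModuleCat.ofHom g₀
  have hg1 : g₀ (Submodule.Quotient.mk 1) = w.1 := by
    change (1 : R) • w.1 = w.1
    exact one_smul R _
  have hg : g ≫ E.cocomplex.d (n + 1) (n + 2) = 0 := by
    refine ModuleCat.hom_ext (Submodule.linearMap_qext _ (LinearMap.ext_ring ?_))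
    exact (congrArg (E.cocomplex.d (n + 1) (n + 2)).hom hg1).trans hw
  obtain ⟨s, hs, h0⟩ := hT t (E.extMk g (n + 2) rfl hg)
  have h1 : E.extMk ((s • 𝟙 _) ≫ g) (n + 2) rfl (by simp [hg]) = 0 := by
    rw [← E.mk₀_comp_extMk g (n + 2) rfl hg, Abelian.Ext.mk₀_smul, Abelian.Ext.smul_comp,
      Abelian.Ext.mk₀_id_comp, h0]
  obtain ⟨g', hg'⟩ := (E.extMk_eq_zero_iff _ (n + 2) rfl _ n rfl).mp h1
  let v : idealTorsion I (E.cocomplex.X n) := ⟨g'.hom (Submodule.Quotient.mk 1), t, fun a ha => by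
    rw [← map_smul, ← Submodule.Quotient.mk_smul, smul_eq_mul, mul_one,
      (Submodule.Quotient.mk_eq_zero _).mpr ha, map_zero]⟩
  have hv : (K.d n (n + 1)).hom v = s • w := by
    refine Subtype.ext ?_
    have h := congrArg (fun k => k.hom (Submodule.Quotient.mk 1)) hg'
    refine h.trans ?_
    change g₀ (s • Submodule.Quotient.mk 1) = s • w.1
    rw [map_smul, hg1]
  have hz' : (K.toCycles n (n + 1)).hom v = s • z := by
    apply (ModuleCat.mono_iff_injective (K.iCycles (n + 1))).mp inferInstance
    rw [map_smul]
    exact (congrArg (fun k => k.hom v) (K.toCycles_i n (n + 1))).trans hv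
  refine ⟨s, hs, e.toLinearEquiv.injective ?_⟩
  rw [map_smul, map_zero]
  change s • e.hom.hom y = 0
  rw [← hz, ← map_smul]
  exact (congrArg (K.homologyπ (n + 1)).hom hz').symm.trans
    (congrArg (fun k => k.hom v) (K.toCycles_comp_homologyπ n (n + 1)))

end LocalCohomology

section CohenMacaulay

open RingTheory.Sequence

variable {R : Type u} [CommRing R]

theorem isDepthZeroQuotient_of_exists_pow {I : Ideal R} {b : R} (hb : b ∉ I)
    (h : ∀ J : Ideal R, J ≠ ⊤ → ∀ a ∈ J, ∃ k : ℕ, a ^ k * b ∈ I) : IsDepthZeroQuotient I := by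
  intro J hJ hJ'
  let C : Ideal R := I.colon {b}
  have hC : ∃ N, J ^ N ≤ C := Ideal.exists_pow_le_of_le_radical_of_fg (fun a ha => (h J hJ' a ha).imp
      fun _ hk => Submodule.mem_colon_singleton.mpr hk) hJ
  classical
  -- the largest power of `J` that does not annihilate `b` contains the required element
  obtain ⟨N, hN⟩ : ∃ N, Nat.find hC = N + 1 := by
    refine Nat.exists_eq_succ_of_ne_zero fun h0 => hb ?_
    have h1 := Nat.find_spec hC
    rw [h0, pow_zero, Ideal.one_eq_top] at h1
    simpa using Submodule.mem_colon_singleton.mp (h1 (Submodule.mem_top (x := (1 : R))))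
  have hlt := Nat.find_min hC (show N < Nat.find hC by omega)
  obtain ⟨w, hw, hwC⟩ := SetLike.not_le_iff_exists.mp hlt
  refine ⟨w * b, fun hwb => hwC (Submodule.mem_colon_singleton.mpr hwb), fun a ha => ?_⟩
  have h1 := Nat.find_spec hC
  rw [hN, pow_succ'] at h1
  have h2 : a * w * b ∈ I := Submodule.mem_colon_singleton.mp (h1 (Ideal.mul_mem_mul ha hw))
  rwa [mul_assoc] at h2

/-- The localization of `R/I` at a minimal prime over the annihilator of the class of `b` has depth
zero. -/
theorem isDepthZeroQuotient_of_mem_minimalPrimes {I : Ideal R} {b : R} (p : Ideal R) [p.IsPrime]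
    (hp : p ∈ (I.colon {b}).minimalPrimes) :
    IsDepthZeroQuotient (I.map (algebraMap R (Localization.AtPrime p))) := by
  refine isDepthZeroQuotient_of_exists_pow (b := algebraMap R _ b) (fun hb => ?_)
    fun J hJ a ha => ?_
  · rw [IsLocalization.algebraMap_mem_map_algebraMap_iff p.primeCompl] at hb
    obtain ⟨u, hu, hub⟩ := hb
    exact hu (hp.1.2 (Submodule.mem_colon_singleton.mpr hub))
  · obtain ⟨⟨r, s⟩, hr⟩ := IsLocalization.surj p.primeCompl a
    have hrJ : algebraMap R (Localization.AtPrime p) r ∈ J := hr ▸ J.mul_mem_right _ ha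
    have hrp : r ∈ p := by
      by_contra hrp
      exact hJ (Ideal.eq_top_of_isUnit_mem _ hrJ
        (IsLocalization.map_units (Localization.AtPrime p) (⟨r, hrp⟩ : p.primeCompl)))
    obtain ⟨k, hk⟩ : algebraMap R (Localization.AtPrime p) r ∈
        ((I.colon {b}).map (algebraMap R (Localization.AtPrime p))).radical := by
      rw [IsLocalization.AtPrime.radical_map_of_mem_minimalPrimes _ p _ hp]
      exact Ideal.mem_map_of_mem _ hrp
    rw [← map_pow, IsLocalization.algebraMap_mem_map_algebraMap_iff p.primeCompl] at hk
    obtain ⟨u, hu, hk⟩ := hk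
    have hk' := Ideal.mem_map_of_mem (algebraMap R (Localization.AtPrime p))
      (Submodule.mem_colon_singleton.mp hk)
    rw [smul_eq_mul, map_mul, map_mul, map_pow, ← hr] at hk'
    have hunit := (IsLocalization.map_units (Localization.AtPrime p) (⟨u, hu⟩ : p.primeCompl)).mul
      ((IsLocalization.map_units (Localization.AtPrime p) s).pow k)
    refine ⟨k, (Ideal.unit_mul_mem_iff_mem _ hunit).mp ?_⟩
    convert hk' using 1
    ring

theorem subsingleton_localCohomology_of_not_isSMulRegular (hR : IsCoherentRing R)
    (hG : ∀ (p : Ideal R) [p.IsPrime], HasFiniteGDimension (Localization.AtPrime p))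
    {rs : List R} (hrs : IsWeaklyRegular R rs) {z b : R} (hb : b ∉ Ideal.ofList rs)
    (hz : z * b ∈ Ideal.ofList rs) :
    ∃ (p : Ideal R) (_ : p.IsPrime), Ideal.ofList (rs ++ [z]) ≤ p ∧
      Subsingleton (LocalizedModule p.primeCompl
        ((localCohomologyFunctor (Ideal.ofList (rs ++ [z])) (rs.length + 1)).obj
          (ModuleCat.of R R))) := by
  let C : Ideal R := (Ideal.ofList rs).colon {b}
  have hC : C ≠ ⊤ := fun h => hb (by
    have : (1 : R) ∈ C := h ▸ Submodule.mem_top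
    simpa using Submodule.mem_colon_singleton.mp this)
  obtain ⟨m, hm, hCm⟩ := Ideal.exists_le_maximal C hC
  obtain ⟨p, hp, -⟩ := Ideal.exists_minimalPrimes_le hCm
  have := hp.1.1
  refine ⟨p, hp.1.1, ?_, ?_⟩
  · rw [Ideal.ofList_append, Ideal.ofList_singleton]
    refine sup_le (fun a ha => hp.1.2 ?_) ((Ideal.span_singleton_le_iff_mem _).mpr
      (hp.1.2 (Submodule.mem_colon_singleton.mpr hz)))
    refine Submodule.mem_colon_singleton.mpr ?_
    exact Ideal.mul_mem_right _ _ ha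
  set I := Ideal.ofList (rs ++ [z])
  let T := Localization.AtPrime p
  have hrsT : IsWeaklyRegular T (rs.map (algebraMap R T)) :=
    IsWeaklyRegular.of_isLocalization T p.primeCompl hrs
  have hI : IsDepthZeroQuotient (Ideal.ofList (rs.map (algebraMap R T))) := by
    rw [← Ideal.map_ofList]
    exact isDepthZeroQuotient_of_mem_minimalPrimes p hp
  have hfg : I.FG := by
    exact Submodule.fg_span (List.finite_toSet (rs ++ [z]))
  have hExt : ∀ (t : ℕ) (ξ : ModExt R (R ⧸ I ^ t) R (rs.length + 1)),
      ∃ s ∈ p.primeCompl, s • ξ = 0 := by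
    intro t ξ
    have : Module.FinitePresentation R (R ⧸ I ^ t) :=
      Module.finitePresentation_of_surjective (I ^ t).mkQ (I ^ t).mkQ_surjective
        (by rw [Submodule.ker_mkQ]; exact hfg.pow)
    let gM := TensorProduct.mk R T (R ⧸ I ^ t) 1
    have := finitePresentation_localized p.primeCompl T gM
    refine exists_smul_eq_zero_of_subsingleton_ext_localized p.primeCompl T hR rs.length gM ?_ ξ
    have h := (hG p).subsingleton_ext (hR.localized p.primeCompl T) hrsT hI
      (localizedMap p.primeCompl T gM (Algebra.linearMap R T) (I ^ t).mkQ)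
      (IsLocalizedModule.map_surjective _ _ _ _ (I ^ t).mkQ_surjective)
    rwa [List.length_map] at h
  refine LocalizedModule.subsingleton_iff.mpr fun y => ?_
  exact exists_smul_eq_zero_localCohomology p.primeCompl I _ rs.length hExt y

theorem IsStrongParameterSequence.isWeaklyRegular (hR : IsCoherentRing R)
    (hG : ∀ (p : Ideal R) [p.IsPrime], HasFiniteGDimension (Localization.AtPrime p)) {n : ℕ} :
    ∀ {x : Fin n → R}, IsStrongParameterSequence x → IsWeaklyRegular R (List.ofFn x) := by
  induction n with
  | zero => exact fun _ => by simp
  | succ n ih =>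
    intro x hx
    have hrs : IsWeaklyRegular R (List.ofFn fun i => x i.castSucc) :=
      ih fun i h hi => hx i (h.trans n.le_succ) hi
    have happ : List.ofFn x = List.ofFn (fun i => x i.castSucc) ++ [x (Fin.last n)] := by
      rw [List.ofFn_succ', List.concat_eq_append]
    have hseq : seqIdeal x = Ideal.ofList (List.ofFn x) := by
      simp only [seqIdeal, Ideal.ofList, Set.range, List.mem_ofFn]
    rw [happ, isWeaklyRegular_append_iff, isWeaklyRegular_singleton_iff,
      isSMulRegular_quotient_iff_mem_of_smul_mem, smul_eq_mul, Ideal.mul_top]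
    refine ⟨hrs, fun b hzb => ?_⟩
    by_contra hb
    obtain ⟨p, hp, hle, hss⟩ :=
      subsingleton_localCohomology_of_not_isSMulRegular hR hG hrs hb hzb
    rw [← happ, ← hseq, List.length_ofFn] at hss
    rw [← happ, ← hseq] at hle
    exact not_subsingleton_iff_nontrivial.mpr
      ((hx (n + 1) le_rfl n.succ_pos).nontrivial p hle) hss

theorem IsGorensteinRing.hasFiniteGDimension (hR : IsCoherentRing R) (h : IsGorensteinRing R)
    (p : Ideal R) [p.IsPrime] (A : Type u) [CommRing A] [Algebra R A]
    [IsLocalization.AtPrime A p] : HasFiniteGDimension A := by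
  obtain ⟨m, hm, hpm⟩ := Ideal.exists_le_maximal p Ideal.IsPrime.ne_top'
  have hle : m.primeCompl ≤ p.primeCompl := fun a ha hap => ha (hpm hap)
  let Rm := Localization.AtPrime m
  let : Algebra Rm A := IsLocalization.localizationAlgebraOfSubmonoidLe Rm A _ _ hle
  have : IsScalarTower R Rm A := IsLocalization.localization_isScalarTower_of_submonoid_le Rm A _ _ hle
  have := IsLocalization.isLocalization_of_submonoid_le Rm A _ _ hle
  have hRm : IsCoherentRing Rm := hR.localized m.primeCompl Rm
  exact ((h m).hasFiniteGDimension hRm).localized (p.primeCompl.map (algebraMap R Rm)) A hRm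

end CohenMacaulay

end CoherentGorenstein

theorem proposition5p6 (R : Type*) [CommRing R]
    (hcoh : CoherentGorenstein.IsCoherentRing R)
    (hgor : CoherentGorenstein.IsGorensteinRing R) :
    CoherentGorenstein.IsLocallyCohenMacaulayRing R := by
  intro q _ n x hn hx
  let S := Localization.AtPrime q
  have hS : CoherentGorenstein.IsCoherentRing S := hcoh.localized q.primeCompl S
  have hG : ∀ (p : Ideal S) [p.IsPrime],
      CoherentGorenstein.HasFiniteGDimension (Localization.AtPrime p) := by
    intro p _
    have := IsLocalization.isLocalization_isLocalization_atPrime_isLocalization q.primeCompl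
      (Localization.AtPrime p) p
    exact hgor.hasFiniteGDimension hcoh (p.comap (algebraMap R S)) _
  refine ⟨hx.isWeaklyRegular hS hG, ?_⟩
  have h : CoherentGorenstein.seqIdeal x ≠ ⊤ := (hx n le_rfl hn).ne_top
  rw [smul_eq_mul, Ideal.mul_top]
  intro htop
  apply h
  rw [htop]
  simp only [CoherentGorenstein.seqIdeal, Ideal.ofList, Set.range, List.mem_ofFn]
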